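/- **Thermal area law for fermion lattice systems.** Let $\Gamma$ be a lattice (a set of sites) and let $\mathcal A$ be the CAR algebra over $\Gamma$, i.e. the $C^*$-algebra generated by annihilation operators $c_i$ ($i\in\Gamma$) with $\{c_i^*,c_j\}=\delta_{ij}\mathbf 1$ and $\{c_i,c_j\}=0$. For $I\subset\Gamma$ let $\mathcal A(I)$ be the $C^*$-subalgebra generated by $\{c_i : i\in I\}$; for finite $I$ it is isomorphic to $M_{2^{|I|}}(\mathbb C)$. Let $\Theta$ be the automorphism with $\Theta(c_i)=-c_i$; an element $a$ is even if $\Theta(a)=a$, and a state $\psi$ is even if $\psi\circ\Theta=\psi$. Let $\psi_I$ denote the restriction of a state $\psi$ to $\mathcal A(I)$. *Entropies.* For a state $\psi$ and finite $I$ let $S_I(\psi)=-\mathrm{Tr}(D\log D)$, where $D$ is the density matrix of $\psi_I$ with respect to the matrix trace $\mathrm{Tr}$ on $\mathcal A(I)$. For finite $I$ and $J\subset I^c$, finite or infinite, put $$\widetilde S_{I|J}(\psi)=\inf_{\Lambda\subset J,\ \Lambda\text{ finite}}\bigl\{S_{I\cup\Lambda}(\psi)-S_\Lambda(\psi)\bigr\},\qquad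 I_\psi(I:J)=S_I(\psi)-\widetilde S_{I|J}(\psi),$$ and $\widetilde S_I(\psi)=\widetilde S_{I|I^c}(\psi)$. *Thermal equilibrium.* An even potential is a map $\Phi$ that assigns to each finite $K\subset\Gamma$ an even self-adjoint element $\Phi(K)\in\mathcal A(K)$. Assume that for every finite $I$ the surface energy $$H_{\partial I}=\sum_{K:\ K\cap I\ne\emptyset,\ K\cap I^c\ne\emptyset}\Phi(K)\in\mathcal A$$ exists, as the norm limit of the partial sums over $K\subset\Lambda$ along the finite regions $\Lambda\nearrow\Gamma$, and let $H_I=\sum_{K\subset I}\Phi(K)$. For $\beta>0$, a state $\varphi$ of $\mathcal A$ satisfies local thermodynamical stability (LTS) with respect to $\Phi$ at inverse temperature $\beta$ if for every finite $I$ $$\varphi(H_I+H_{\partial I})-\tfrac1\beta\widetilde S_I(\varphi)\ \le\ \psi(H_I+H_{\partial I})-\tfrac1\beta\widetilde S_I(\psi)$$ for all states $\psi$ of $\mathcal A$ with $\psi_{I^c}=\varphi_{I^c}$. **Theorem.** Let $\Phi$ be an even potential whose surface energies all exist, let $\beta>0$, and let $\varphi$ be an even state of $\mathcal A$ that satisfies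 LTS with respect to $\Phi$ at $\beta$. Let $A\subset\Gamma$ be finite. Then there is a unique state $\varphi_A\otimes_{\mathrm{car}}\varphi_{A^c}$ of $\mathcal A$ (the product-state extension) with $$(\varphi_A\otimes_{\mathrm{car}}\varphi_{A^c})(ab)=\varphi(a)\varphi(b)\qquad(a\in\mathcal A(A),\ b\in\mathcal A(A^c)),$$ and for every finite or infinite $B\subset A^c$ $$I_\varphi(A:B)\ \le\ I_\varphi(A:A^c)\ \le\ \beta\,(\varphi_A\otimes_{\mathrm{car}}\varphi_{A^c}-\varphi)(H_{\partial A})\ \le\ 2\beta\,\|H_{\partial A}\|.$$ -/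

import Mathlib

open Filter Topology
open scoped ComplexOrder ComplexConjugate

/-! ### The fermion Fock space and the CAR algebra over a set `Γ` of sites -/

/-- The fermion Fock space over the sites `Γ`: the Hilbert space with orthonormal basis `e_S`
indexed by the finite sets `S` of occupied sites. -/
abbrev FermionFock (Γ : Type*) : Type _ := lp (fun _ : Finset Γ => ℂ) 2

section WeightedComp

variable {ι : Type*}

/-- Square-summability of `S ↦ w S * f (g S)` together with the norm estimate. -/
theorem sum_weighted_comp_le (w : ι → ℂ) (g : ι → ι) (hw : ∀ S, ‖w S‖ ≤ 1)
    (hg : Set.InjOn g {S | w S ≠ 0}) (f : lp (fun _ : ι => ℂ) 2) (s : Finset ι) :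
    ∑ S ∈ s, ‖w S * f (g S)‖ ^ (2 : ENNReal).toReal ≤ ‖f‖ ^ (2 : ENNReal).toReal := by
  classical
  have h2 : (0 : ℝ) < (2 : ENNReal).toReal := by norm_num
  calc ∑ S ∈ s, ‖w S * f (g S)‖ ^ (2 : ENNReal).toReal
      = ∑ S ∈ s with w S ≠ 0, ‖w S * f (g S)‖ ^ (2 : ENNReal).toReal := by
        rw [Finset.sum_filter]
        refine Finset.sum_congr rfl fun S _ => ?_
        by_cases h : w S = 0
        · simp [h]
        · simp [h]
    _ ≤ ∑ S ∈ s with w S ≠ 0, ‖f (g S)‖ ^ (2 : ENNReal).toReal := by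
        refine Finset.sum_le_sum fun S _ => ?_
        refine Real.rpow_le_rpow (norm_nonneg _) ?_ h2.le
        rw [norm_mul]
        exact mul_le_of_le_one_left (norm_nonneg _) (hw S)
    _ = ∑ S ∈ (s.filter fun S => w S ≠ 0).image g, ‖f S‖ ^ (2 : ENNReal).toReal := by
        rw [Finset.sum_image]
        intro x hx y hy h
        exact hg (by simpa using (Finset.mem_filter.1 hx).2)
          (by simpa using (Finset.mem_filter.1 hy).2) h
    _ ≤ ‖f‖ ^ (2 : ENNReal).toReal := lp.sum_rpow_le_norm_rpow h2 f _

/-- The bounded operator `(T f) S = w S * f (g S)` on `ℓ²(ι)`, where `|w| ≤ 1` and `g` is injective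
on the support of `w`. -/
noncomputable def weightedComp (w : ι → ℂ) (g : ι → ι) (hw : ∀ S, ‖w S‖ ≤ 1)
    (hg : Set.InjOn g {S | w S ≠ 0}) :
    lp (fun _ : ι => ℂ) 2 →L[ℂ] lp (fun _ : ι => ℂ) 2 :=
  LinearMap.mkContinuous
    { toFun := fun f => ⟨fun S => w S * f (g S), memℓp_gen' (sum_weighted_comp_le w g hw hg f)⟩
      map_add' := fun f₁ f₂ => by ext S; exact mul_add _ _ _
      map_smul' := fun a f => by ext S; exact mul_left_comm _ _ _ }
    1
    (fun f => by
      rw [one_mul]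
      exact lp.norm_le_of_forall_sum_le (by norm_num) (norm_nonneg _)
        (sum_weighted_comp_le w g hw hg f))

@[simp] theorem weightedComp_apply (w : ι → ℂ) (g : ι → ι) (hw : ∀ S, ‖w S‖ ≤ 1)
    (hg : Set.InjOn g {S | w S ≠ 0}) (f : lp (fun _ : ι => ℂ) 2) (S : ι) :
    weightedComp w g hw hg f S = w S * f (g S) := rfl

end WeightedComp

section CAR

variable {Γ : Type*}

open scoped Classical in
/-- The fermionic sign `(-1) ^ #{j ∈ S : j < i}` for a fixed well-ordering `<` of the sites. -/
noncomputable def fermionSign (i : Γ) (S : Finset Γ) : ℂ :=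
  (-1) ^ (S.filter fun j => WellOrderingRel j i).card

theorem norm_fermionSign (i : Γ) (S : Finset Γ) : ‖fermionSign i S‖ = 1 := by
  simp [fermionSign]

open scoped Classical in
/-- The annihilation operator at `i`: `c_i e_S = ± e_{S \ {i}}` if `i ∈ S`, and `c_i e_S = 0`
otherwise. In coordinates, `(c_i f)(S) = ± f (S ∪ {i})` if `i ∉ S`, and `(c_i f)(S) = 0`
otherwise. -/
noncomputable def fockAnnihilate (i : Γ) : FermionFock Γ →L[ℂ] FermionFock Γ :=
  weightedComp (fun S => if i ∈ S then 0 else fermionSign i S) (fun S => insert i S)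
    (fun S => by
      split_ifs
      · simp
      · exact (norm_fermionSign i S).le)
    (by
      intro S hS T hT h
      have hS' : i ∉ S := fun hi => hS (if_pos hi)
      have hT' : i ∉ T := fun hi => hT (if_pos hi)
      dsimp only at h
      rw [← Finset.erase_insert hS', h, Finset.erase_insert hT'])

open scoped Classical in
theorem fermionSign_insert (i j : Γ) (S : Finset Γ) (hj : j ∉ S) :
    fermionSign i (insert j S) = (if WellOrderingRel j i then -1 else 1) * fermionSign i S := by
  unfold fermionSign
  rw [Finset.filter_insert]
  split_ifs with h
  · rw [Finset.card_insert_of_notMem (by simp [hj]), pow_succ]; ring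
  · simp

theorem fermionSign_mul_self (i : Γ) (S : Finset Γ) : fermionSign i S * fermionSign i S = 1 := by
  unfold fermionSign; rw [← mul_pow]; simp

open scoped Classical in
theorem fockAnnihilate_apply (i : Γ) (f : FermionFock Γ) (S : Finset Γ) :
    (fockAnnihilate i f) S = if i ∈ S then 0 else fermionSign i S * f (insert i S) := by
  change (if i ∈ S then 0 else fermionSign i S) * f (insert i S) = _
  split_ifs <;> simp

open scoped Classical in
/-- The coordinate form of the creation operator `c_i^*`. -/
theorem star_fockAnnihilate_apply (i : Γ) (f : FermionFock Γ) (S : Finset Γ) :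
    (star (fockAnnihilate i) f) S = if i ∈ S then fermionSign i S * f (S.erase i) else 0 := by
  have hcr : ∃ T : FermionFock Γ →L[ℂ] FermionFock Γ, ∀ f S,
      (T f) S = (if i ∈ S then fermionSign i S else 0) * f (S.erase i) := by
    refine ⟨weightedComp _ _ (fun S => ?_) ?_, fun f S => rfl⟩
    · split_ifs
      · exact (norm_fermionSign i S).le
      · simp
    · intro S hS T hT h
      have hS' : i ∈ S := by_contra fun hi => hS (if_neg hi)
      have hT' : i ∈ T := by_contra fun hi => hT (if_neg hi)
      replace h : S.erase i = T.erase i := h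
      rw [← Finset.insert_erase hS', h, Finset.insert_erase hT']
  obtain ⟨T, hT⟩ := hcr
  have hadj : T = star (fockAnnihilate i) := by
    rw [ContinuousLinearMap.star_eq_adjoint, ContinuousLinearMap.eq_adjoint_iff]
    intro f g
    rw [lp.inner_eq_tsum, lp.inner_eq_tsum]
    have hinv : Function.Involutive
        (fun S : Finset Γ => if i ∈ S then S.erase i else insert i S) := by
      intro S
      by_cases h : i ∈ S <;> simp [h]
    rw [← Equiv.tsum_eq hinv.toPerm]
    refine tsum_congr fun S => ?_
    change inner ℂ ((T f) (if i ∈ S then S.erase i else insert i S))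
      (g (if i ∈ S then S.erase i else insert i S)) = _
    rw [hT, fockAnnihilate_apply]
    by_cases h : i ∈ S
    · simp [h]
    · have hirr : ¬ WellOrderingRel i i := irrefl_of WellOrderingRel i
      have hs : fermionSign i (insert i S) = fermionSign i S := by
        rw [fermionSign_insert i i S h, if_neg hirr, one_mul]
      have hconj : conj (fermionSign i S) = fermionSign i S := by
        simp [fermionSign]
      simp [h, hs, hconj]
      ring
  rw [← hadj, hT]
  split_ifs <;> simp

/-- The canonical anticommutation relation `{c_i, c_j} = 0`. -/
theorem fockAnnihilate_anticomm (i j : Γ) :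
    fockAnnihilate i * fockAnnihilate j + fockAnnihilate j * fockAnnihilate i = 0 := by
  classical
  ext f S
  change (fockAnnihilate i (fockAnnihilate j f)) S + (fockAnnihilate j (fockAnnihilate i f)) S = 0
  simp only [fockAnnihilate_apply, Finset.mem_insert]
  by_cases hij : i = j
  · subst hij
    simp
  · have hji : ¬ j = i := fun h => hij h.symm
    by_cases hi : i ∈ S
    · simp [hi]
    by_cases hj : j ∈ S
    · simp [hj]
    simp only [hi, hj, hij, hji, or_self, if_false]
    rw [fermionSign_insert j i S hi, fermionSign_insert i j S hj, Finset.insert_comm j i S]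
    rcases trichotomous_of WellOrderingRel i j with h | h | h
    · rw [if_pos h, if_neg (asymm_of WellOrderingRel h)]; ring
    · exact absurd h hij
    · rw [if_pos h, if_neg (asymm_of WellOrderingRel h)]; ring

open scoped Classical in
/-- The canonical anticommutation relation `{c_i^*, c_j} = δ_{ij}`. -/
theorem fockAnnihilate_star_anticomm (i j : Γ) :
    star (fockAnnihilate i) * fockAnnihilate j + fockAnnihilate j * star (fockAnnihilate i) =
      if i = j then 1 else 0 := by
  ext f S
  change (star (fockAnnihilate i) (fockAnnihilate j f)) S +
    (fockAnnihilate j (star (fockAnnihilate i) f)) S = _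
  simp only [fockAnnihilate_apply, star_fockAnnihilate_apply, Finset.mem_insert,
    Finset.mem_erase]
  by_cases hij : i = j
  · subst hij
    have hirr : ¬ WellOrderingRel i i := irrefl_of WellOrderingRel i
    by_cases hi : i ∈ S
    · obtain ⟨T, hT, rfl⟩ : ∃ T, i ∉ T ∧ S = insert i T :=
        ⟨S.erase i, by simp, (Finset.insert_erase hi).symm⟩
      simp only [fermionSign_insert i i T hT, hirr, if_false, one_mul, Finset.mem_insert, true_or,
        if_true, ne_eq, not_true_eq_false, false_and, Finset.erase_insert hT, add_zero,
        ← mul_assoc, fermionSign_mul_self]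
      rfl
    · simp only [hi, if_false, true_or, if_true, fermionSign_insert i i S hi, hirr, one_mul,
        Finset.erase_insert hi, zero_add, ← mul_assoc, fermionSign_mul_self]
      rfl
  · have hji : ¬ j = i := fun h => hij h.symm
    simp only [hij, hji, if_false, false_or, ne_eq, not_false_eq_true, true_and]
    by_cases hi : i ∈ S
    · by_cases hj : j ∈ S
      · simp [hj]
      · obtain ⟨T, hT, rfl⟩ : ∃ T, i ∉ T ∧ S = insert i T :=
          ⟨S.erase i, by simp, (Finset.insert_erase hi).symm⟩
        have hjT : j ∉ T := fun h => hj (Finset.mem_insert_of_mem h)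
        simp only [hi, hj, if_true, if_false]
        have hirr : ¬ WellOrderingRel i i := irrefl_of WellOrderingRel i
        rw [fermionSign_insert i j _ hj, fermionSign_insert i i T hT,
          fermionSign_insert j i T hT, Finset.insert_comm j i T, Finset.erase_insert hT,
          Finset.erase_insert (by simp [hij, hT])]
        change _ = (0 : ℂ)
        rcases trichotomous_of WellOrderingRel i j with h | h | h
        · rw [if_pos h, if_neg (asymm_of WellOrderingRel h), if_neg hirr]; ring
        · exact absurd h hij
        · rw [if_pos h, if_neg (asymm_of WellOrderingRel h), if_neg hirr]; ring
    · simp [hi]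

/-- The parity operator `(-1)^N`: `e_S ↦ (-1)^{|S|} e_S`. -/
noncomputable def fockParity (Γ : Type*) : FermionFock Γ →L[ℂ] FermionFock Γ :=
  weightedComp (fun S => (-1) ^ S.card) id (fun S => by simp) (Function.injective_id.injOn)

theorem fockParity_mul_self : fockParity Γ * fockParity Γ = 1 := by
  ext f S
  change (-1 : ℂ) ^ S.card * ((-1) ^ S.card * f S) = f S
  rw [← mul_assoc, ← mul_pow]
  simp

theorem star_fockParity : star (fockParity Γ) = fockParity Γ := by
  rw [ContinuousLinearMap.star_eq_adjoint]
  symm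
  rw [ContinuousLinearMap.eq_adjoint_iff]
  intro f g
  rw [lp.inner_eq_tsum, lp.inner_eq_tsum]
  refine tsum_congr fun S => ?_
  simp [fockParity, mul_left_comm, mul_assoc]

theorem fockParity_conj_annihilate (i : Γ) :
    fockParity Γ * fockAnnihilate i * fockParity Γ = -fockAnnihilate i := by
  classical
  ext f S
  change (-1 : ℂ) ^ S.card * ((if i ∈ S then 0 else fermionSign i S) *
    ((-1 : ℂ) ^ (insert i S).card * f (insert i S))) =
      -((if i ∈ S then 0 else fermionSign i S) * f (insert i S))
  by_cases h : i ∈ S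
  · simp [h]
  · rw [Finset.card_insert_of_notMem h, if_neg h, pow_succ]
    have : (-1 : ℂ) ^ S.card * (-1) ^ S.card = 1 := by rw [← mul_pow]; simp
    linear_combination (-(fermionSign i S * f (insert i S))) * this

/-- Conjugation by the parity operator, as a `*`-automorphism of all bounded operators. -/
noncomputable def fockGrading (Γ : Type*) :
    (FermionFock Γ →L[ℂ] FermionFock Γ) →⋆ₐ[ℂ] (FermionFock Γ →L[ℂ] FermionFock Γ) where
  toFun a := fockParity Γ * a * fockParity Γ
  map_one' := by simp [fockParity_mul_self]
  map_mul' a b := by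
    simp only [mul_assoc]
    rw [← mul_assoc (fockParity Γ) (fockParity Γ), fockParity_mul_self, one_mul]
  map_zero' := by simp
  map_add' a b := by simp [mul_add, add_mul]
  commutes' r := by
    rw [Algebra.algebraMap_eq_smul_one]
    simp [fockParity_mul_self]
  map_star' a := by
    simp [star_mul, star_fockParity, mul_assoc]

variable (Γ) in
/-- The CAR algebra over `Γ`, as the norm-closed `*`-algebra of operators on Fock space that is
generated by all annihilation operators. -/
noncomputable def carSubalgebra : StarSubalgebra ℂ (FermionFock Γ →L[ℂ] FermionFock Γ) :=
  (StarAlgebra.adjoin ℂ (Set.range (fockAnnihilate (Γ := Γ)))).topologicalClosure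

variable (Γ) in
/-- The `C*`-algebra of the fermion lattice system over `Γ`. -/
abbrev CARAlgebra : Type _ := ↥(carSubalgebra Γ)

/-- The annihilation operator `c_i` as an element of the CAR algebra; the creation operator is
`star (carC i)`. -/
noncomputable def carC (i : Γ) : CARAlgebra Γ :=
  ⟨fockAnnihilate i,
    StarSubalgebra.le_topologicalClosure _ (StarAlgebra.subset_adjoin ℂ _ ⟨i, rfl⟩)⟩

theorem fockGrading_mem (a : FermionFock Γ →L[ℂ] FermionFock Γ) (ha : a ∈ carSubalgebra Γ) :
    fockGrading Γ a ∈ carSubalgebra Γ := by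
  have hcont : Continuous (fockGrading Γ) := by
    change Continuous fun a => fockParity Γ * a * fockParity Γ
    fun_prop
  have hle : carSubalgebra Γ ≤ (carSubalgebra Γ).comap (fockGrading Γ) := by
    refine StarSubalgebra.topologicalClosure_minimal ?_ ?_
    · refine StarAlgebra.adjoin_le ?_
      rintro _ ⟨i, rfl⟩
      change fockParity Γ * fockAnnihilate i * fockParity Γ ∈ carSubalgebra Γ
      rw [fockParity_conj_annihilate]
      exact neg_mem (carC i).2
    · exact (StarSubalgebra.isClosed_topologicalClosure _).preimage hcont
  exact hle ha

variable (Γ) in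
/-- The fermion grading `Θ`, with `Θ (c_i) = - c_i`. -/
noncomputable def carGrading : CARAlgebra Γ →⋆ₐ[ℂ] CARAlgebra Γ :=
  ((fockGrading Γ).comp (carSubalgebra Γ).subtype).codRestrict (carSubalgebra Γ)
    (fun a => fockGrading_mem a.1 a.2)

theorem carGrading_carC (i : Γ) : carGrading Γ (carC i) = -carC i :=
  Subtype.ext (fockParity_conj_annihilate i)

/-- The algebra `𝓐(I)` of a finite or infinite region `I`: the `C*`-subalgebra generated by the
`c_i`, `i ∈ I`. -/
noncomputable def regionAlgebra (I : Set Γ) : StarSubalgebra ℂ (CARAlgebra Γ) :=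
  (StarAlgebra.adjoin ℂ (carC '' I)).topologicalClosure

/-! ### States -/

/-- A state of the CAR algebra: a positive normalized linear functional. -/
structure IsState (φ : CARAlgebra Γ →L[ℂ] ℂ) : Prop where
  nonneg : ∀ a, 0 ≤ φ (star a * a)
  map_one : φ 1 = 1

/-- Invariance under the fermion grading. -/
def IsEvenState (φ : CARAlgebra Γ →L[ℂ] ℂ) : Prop :=
  ∀ a, φ (carGrading Γ a) = φ a

/-- `ω` is a product-state extension `φ_I ⊗_car ψ_{Iᶜ}`: a state of the whole algebra with
`ω (a b) = φ a * ψ b` for all `a ∈ 𝓐(I)` and `b ∈ 𝓐(Iᶜ)`. -/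
structure IsCARProduct (I : Set Γ) (φ ψ ω : CARAlgebra Γ →L[ℂ] ℂ) : Prop where
  isState : IsState ω
  map_mul : ∀ a ∈ regionAlgebra I, ∀ b ∈ regionAlgebra Iᶜ, ω (a * b) = φ a * ψ b

/-! ### Entropies -/

/-- The product of the annihilation operators over the sites of `S`, in a fixed order. -/
noncomputable def carMonomial (S : Finset Γ) : CARAlgebra Γ :=
  (S.toList.map carC).prod

/-- The projection `∏_{i ∈ I} c_i c_i^*` onto the configurations without a particle in `I`
(the factors commute). -/
noncomputable def carVacuum (I : Finset Γ) : CARAlgebra Γ :=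
  (I.toList.map fun i => carC i * star (carC i)).prod

/-- The density matrix of the restriction of `ψ` to `𝓐(I)`, `I` finite. The elements
`E S T = star (carMonomial S) * carVacuum I * carMonomial T` with `S, T ⊆ I` are matrix units of
`𝓐(I) ≅ M_{2^|I|}(ℂ)`, and the density matrix `D` with `ψ a = Tr (D a)` on `𝓐(I)` has the entries
`D S T = ψ (E T S)`. The ordering of the factors in the monomials only changes `D` by conjugation
with a diagonal matrix of signs. -/
noncomputable def densityMatrix (I : Finset Γ) (ψ : CARAlgebra Γ →L[ℂ] ℂ) :
    Matrix I.powerset I.powerset ℂ :=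
  Matrix.of fun S T => ψ (star (carMonomial T.1) * carVacuum I * carMonomial S.1)

open scoped Classical in
/-- The von Neumann entropy `S_I(ψ) = - Tr (D log D)`, with `0 log 0 = 0`. -/
noncomputable def vonNeumannEntropy (I : Finset Γ) (ψ : CARAlgebra Γ →L[ℂ] ℂ) : ℝ :=
  -(Matrix.trace (densityMatrix I ψ * cfc Real.log (densityMatrix I ψ))).re

open scoped Classical in
/-- The conditional entropy of `ψ` on `I` given `J`: the infimum of `S_{I ∪ Λ}(ψ) - S_Λ(ψ)` over
all finite `Λ ⊆ J`, taken in the extended reals. -/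
noncomputable def condEntropy (I : Finset Γ) (J : Set Γ) (ψ : CARAlgebra Γ →L[ℂ] ℂ) : EReal :=
  ⨅ Λ : {Λ : Finset Γ // (Λ : Set Γ) ⊆ J},
    ((vonNeumannEntropy (I ∪ Λ.1) ψ - vonNeumannEntropy Λ.1 ψ : ℝ) : EReal)

/-- The mutual entropy of `ψ` between the finite region `I` and the region `J`. -/
noncomputable def mutualEntropy (ψ : CARAlgebra Γ →L[ℂ] ℂ) (I : Finset Γ) (J : Set Γ) : EReal :=
  (vonNeumannEntropy I ψ : EReal) - condEntropy I J ψ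

/-! ### Potentials and local thermodynamical stability -/

variable (Γ) in
/-- An even potential: a map `K ↦ Φ K` on finite regions with `Φ K = (Φ K)^*` in the even part of
`𝓐(K)`. -/
structure EvenPotential where
  toFun : Finset Γ → CARAlgebra Γ
  isSelfAdjoint : ∀ K, star (toFun K) = toFun K
  mem_region : ∀ K : Finset Γ, toFun K ∈ regionAlgebra (K : Set Γ)
  even : ∀ K, carGrading Γ (toFun K) = toFun K

/-- The inner local Hamiltonian `H_I`, the sum of `Φ K` over `K ⊆ I`. -/
noncomputable def EvenPotential.innerHamiltonian (Φ : EvenPotential Γ) (I : Finset Γ) :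
    CARAlgebra Γ :=
  ∑ K ∈ I.powerset, Φ.toFun K

open scoped Classical in
/-- The part of the surface energy of `I` inside the finite region `Λ`: the sum of `Φ K` over all
`K ⊆ Λ` that meet both `I` and its complement. -/
noncomputable def EvenPotential.surfacePart (Φ : EvenPotential Γ) (I Λ : Finset Γ) :
    CARAlgebra Γ :=
  ∑ K ∈ Λ.powerset with
    ((K ∩ I).Nonempty ∧ (K \ I).Nonempty), Φ.toFun K

/-- All surface energies exist: for each finite `I` the sum of `Φ K` over all `K` that meet both
`I` and its complement converges in norm along the finite regions `Λ ↗ Γ`. -/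
def EvenPotential.HasSurfaceEnergies (Φ : EvenPotential Γ) : Prop :=
  ∀ I : Finset Γ, ∃ H : CARAlgebra Γ, Tendsto (Φ.surfacePart I) atTop (𝓝 H)

/-- The surface energy `H_{∂I}`, meaningful under `HasSurfaceEnergies`. -/
noncomputable def EvenPotential.surfaceEnergy (Φ : EvenPotential Γ) (I : Finset Γ) :
    CARAlgebra Γ :=
  limUnder atTop (Φ.surfacePart I)

/-- The conditional free energy `ψ (H_I + H_{∂I}) - β⁻¹ S(ψ)` of a state `ψ` on `I`, where `S(ψ)`
is the conditional entropy on `I` given the complement of `I`. -/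
noncomputable def conditionalFreeEnergy (Φ : EvenPotential Γ) (β : ℝ) (I : Finset Γ)
    (ψ : CARAlgebra Γ →L[ℂ] ℂ) : EReal :=
  (((ψ (Φ.innerHamiltonian I + Φ.surfaceEnergy I)).re : ℝ) : EReal) -
    ((β⁻¹ : ℝ) : EReal) * condEntropy I (I : Set Γ)ᶜ ψ

/-- Local thermodynamical stability of `φ` with respect to `Φ` at inverse temperature `β`. -/
def IsLTS (Φ : EvenPotential Γ) (β : ℝ) (φ : CARAlgebra Γ →L[ℂ] ℂ) : Prop :=
  ∀ I : Finset Γ, ∀ ψ : CARAlgebra Γ →L[ℂ] ℂ, IsState ψ →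
    (∀ a ∈ regionAlgebra (I : Set Γ)ᶜ, ψ a = φ a) →
    conditionalFreeEnergy Φ β I φ ≤ conditionalFreeEnergy Φ β I ψ

end CAR

/-! ### The entropy functional of Hermitian matrices -/

section MatrixEntropy

open Matrix Polynomial
open scoped Kronecker

variable {m n : Type*} [Fintype m] [Fintype n] [DecidableEq n]

/-! The area law is a single application of the variational principle. The product extension `ω` of
`φ` agrees with `φ` on `𝓐(Aᶜ)`, so it is an admissible trial state in LTS for the region `A`. It
also agrees with `φ` on `𝓐(A)`, so the inner Hamiltonian drops out of the comparison and only the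
surface energy remains. Its conditional entropy on `A` is exactly `S_A(φ)`, so the LTS inequality,
multiplied by `β`, is the bound on the mutual entropy. Contractivity of states gives the norm bound,
and monotonicity in `B` holds because an infimum decreases when its index set grows.

The work lies in the fermionic product state, because `𝓐(A)` and `𝓐(Aᶜ)` commute only up to the
grading. Matrix units of `𝓐(A)` are built from operators `w_S` (`carFrame`) acting on Fock space.
With them `carProduct` is an explicit functional: its positivity comes from a Gram factorization of
the density matrix (`IsState.carProduct_nonneg`), and the product formula from the matrix-unit
relations and evenness (`carProduct_carUnit_mul`). Uniqueness holds because products `a b` span a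
dense subspace (`ext_of_forall_mul`).

For the entropy, the density matrix of `ω` on `A ∪ B` is a Kronecker product up to conjugation by
diagonal signs: the other fermionic signs multiply odd expectations, which vanish for an even state.
Hence `S_{A ∪ B}(ω) = S_A(φ) + S_B(φ)` for finite `B` disjoint from `A`
(`IsCARProduct.vonNeumannEntropy_union`). -/

theorem Matrix.IsHermitian.trace_mul_cfc {M : Matrix n n ℂ} (hM : M.IsHermitian) (f : ℝ → ℝ) :
    (M * cfc f M).trace = ∑ i, ((hM.eigenvalues i * f (hM.eigenvalues i) : ℝ) : ℂ) := by
  rw [hM.cfc_eq, Matrix.IsHermitian.cfc]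
  nth_rewrite 1 [hM.spectral_theorem]
  rw [← map_mul, Matrix.diagonal_mul_diagonal, Unitary.conjStarAlgAut_apply,
    Matrix.trace_mul_comm, ← mul_assoc, Unitary.coe_star_mul_self, one_mul, Matrix.trace_diagonal]
  simp

/-- `Tr (M f(M))` depends on the characteristic polynomial only. -/
theorem Matrix.IsHermitian.re_trace_mul_cfc_of_charpoly {M : Matrix n n ℂ} (hM : M.IsHermitian)
    (f : ℝ → ℝ) (d : m → ℝ) (hd : M.charpoly = ∏ i, (X - C (d i : ℂ))) :
    (M * cfc f M).trace.re = ∑ i, d i * f (d i) := by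
  have hroots : M.charpoly.roots = Multiset.map (fun i => (d i : ℂ)) Finset.univ.val := by
    have h := Polynomial.roots_multiset_prod_X_sub_C
      (Multiset.map (fun i => (d i : ℂ)) Finset.univ.val)
    rw [Multiset.map_map] at h
    rw [hd]
    exact h
  rw [hM.roots_charpoly_eq_eigenvalues] at hroots
  have h := congrArg (fun s : Multiset ℂ => (s.map fun z => z.re * f z.re).sum) hroots
  simp only [Multiset.map_map, Function.comp_apply] at h
  rw [hM.trace_mul_cfc, Complex.re_sum]
  simpa using h

/-- The Kronecker product of the two eigenvector unitaries diagonalizes `A ⊗ₖ B`, and the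
characteristic polynomial is invariant under cyclic permutation of factors. -/
theorem Matrix.IsHermitian.charpoly_kronecker [DecidableEq m] {A : Matrix m m ℂ} {B : Matrix n n ℂ}
    (hA : A.IsHermitian) (hB : B.IsHermitian) :
    (A ⊗ₖ B).charpoly =
      ∏ p : m × n, (X - C ((hA.eigenvalues p.1 * hB.eigenvalues p.2 : ℝ) : ℂ)) := by
  have h : A ⊗ₖ B =
      ((hA.eigenvectorUnitary : Matrix m m ℂ) ⊗ₖ (hB.eigenvectorUnitary : Matrix n n ℂ)) *
      (diagonal (RCLike.ofReal ∘ hA.eigenvalues) ⊗ₖ diagonal (RCLike.ofReal ∘ hB.eigenvalues)) *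
      (star (hA.eigenvectorUnitary : Matrix m m ℂ) ⊗ₖ
        star (hB.eigenvectorUnitary : Matrix n n ℂ)) := by
    rw [← mul_kronecker_mul, ← mul_kronecker_mul]
    nth_rewrite 1 [hA.spectral_theorem]
    nth_rewrite 1 [hB.spectral_theorem]
    simp only [Unitary.conjStarAlgAut_apply]
  rw [h, charpoly_mul_comm, ← mul_assoc, ← mul_kronecker_mul, Unitary.coe_star_mul_self,
    Unitary.coe_star_mul_self, one_kronecker_one, one_mul, diagonal_kronecker_diagonal,
    charpoly_diagonal]
  simp

/-- Additivity of the entropy for a Kronecker product, up to a diagonal conjugation. -/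
theorem Matrix.re_trace_mul_cfc_log_kronecker {l : Type*} [Fintype l] [DecidableEq l] [DecidableEq m]
    {A : Matrix m m ℂ} {B : Matrix n n ℂ} {M : Matrix l l ℂ}
    (hA : A.IsHermitian) (hB : B.IsHermitian) (hM : M.IsHermitian)
    (hA1 : A.trace = 1) (hB1 : B.trace = 1) (e : m × n ≃ l) (ε : m × n → ℂ)
    (hε : ∀ p, ε p * ε p = 1)
    (h : ∀ p q, M (e p) (e q) = ε p * ε q * (A p.1 q.1 * B p.2 q.2)) :
    (M * cfc Real.log M).trace.re =
      (A * cfc Real.log A).trace.re + (B * cfc Real.log B).trace.re := by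
  have hMe : M = reindex e e (diagonal ε * (A ⊗ₖ B) * diagonal ε) := by
    ext x y
    obtain ⟨p, rfl⟩ := e.surjective x
    obtain ⟨q, rfl⟩ := e.surjective y
    rw [h]
    simp [diagonal_mul, mul_diagonal]
    ring
  have hεε : diagonal ε * diagonal ε = 1 := by
    rw [diagonal_mul_diagonal, ← diagonal_one]
    exact congrArg _ (funext hε)
  have hch : M.charpoly =
      ∏ p : m × n, (X - C ((hA.eigenvalues p.1 * hB.eigenvalues p.2 : ℝ) : ℂ)) := by
    rw [hMe, charpoly_reindex, charpoly_mul_comm, ← mul_assoc, hεε, one_mul,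
      hA.charpoly_kronecker hB]
  have hAs : ∑ i, hA.eigenvalues i = 1 := by
    have := hA.trace_eq_sum_eigenvalues
    rw [hA1] at this
    simpa using congrArg Complex.re this.symm
  have hBs : ∑ i, hB.eigenvalues i = 1 := by
    have := hB.trace_eq_sum_eigenvalues
    rw [hB1] at this
    simpa using congrArg Complex.re this.symm
  rw [hM.re_trace_mul_cfc_of_charpoly _ _ hch, hA.trace_mul_cfc, hB.trace_mul_cfc,
    Complex.re_sum, Complex.re_sum]
  simp only [Complex.ofReal_re]
  calc _ = ∑ p : m × n, ((hA.eigenvalues p.1 * Real.log (hA.eigenvalues p.1)) * hB.eigenvalues p.2 +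
        hA.eigenvalues p.1 * (hB.eigenvalues p.2 * Real.log (hB.eigenvalues p.2))) := by
        refine Finset.sum_congr rfl fun p _ => ?_
        -- The logarithm of a product splits only for nonzero factors; a zero eigenvalue makes all
        -- terms vanish.
        by_cases ha : hA.eigenvalues p.1 = 0
        · simp [ha]
        by_cases hb : hB.eigenvalues p.2 = 0
        · simp [hb]
        rw [Real.log_mul ha hb]
        ring
    _ = _ := by
        rw [Finset.sum_add_distrib, Fintype.sum_prod_type, Fintype.sum_prod_type]
        simp only [← Finset.mul_sum, ← Finset.sum_mul, hAs, hBs, mul_one, one_mul]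

end MatrixEntropy

section CARStructure

variable {Γ : Type*}

open scoped Classical

/-! ### States -/

theorem isClosed_carSubalgebra :
    IsClosed (carSubalgebra Γ : Set (FermionFock Γ →L[ℂ] FermionFock Γ)) :=
  StarSubalgebra.isClosed_topologicalClosure _

theorem IsState.map_star {φ : CARAlgebra Γ →L[ℂ] ℂ} (hφ : IsState φ) (a : CARAlgebra Γ) :
    φ (star a) = conj (φ a) := by
  -- Polarization: realness of `φ` on the squares of `1 + a` and `1 + i a` fixes the imaginary and
  -- the real part of `φ (star a)`.
  have h1 := (Complex.nonneg_iff.1 (hφ.nonneg (1 + a))).2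
  have h2 := (Complex.nonneg_iff.1 (hφ.nonneg (1 + Complex.I • a))).2
  have h3 := (Complex.nonneg_iff.1 (hφ.nonneg a)).2
  simp only [star_add, star_one, star_smul, add_mul, mul_add, one_mul, mul_one, map_add,
    smul_mul_smul_comm, map_smul, hφ.map_one, smul_eq_mul] at h1 h2
  simp at h1 h2
  apply Complex.ext
  · simp only [Complex.conj_re]; linarith
  · simp only [Complex.conj_im]; linarith

/-- The Cauchy–Schwarz inequality against `1`: the variance, that is `φ` on the square of `a - φ a •
1`, is nonnegative. -/
theorem IsState.normSq_apply_le {φ : CARAlgebra Γ →L[ℂ] ℂ} (hφ : IsState φ) (a : CARAlgebra Γ) :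
    ‖φ a‖ ^ 2 ≤ (φ (star a * a)).re := by
  have h := (Complex.nonneg_iff.1 (hφ.nonneg (a - φ a • 1))).1
  have hexp : star (a - φ a • (1 : CARAlgebra Γ)) * (a - φ a • 1) =
      star a * a - φ a • star a - conj (φ a) • a + (conj (φ a) * φ a) • 1 := by
    rw [star_sub, star_smul, star_one, sub_mul, mul_sub, mul_sub, mul_smul_comm, mul_one,
      smul_mul_assoc, one_mul, smul_mul_smul_comm, one_mul]
    simp only [RCLike.star_def]
    abel
  rw [hexp] at h
  simp only [map_add, map_sub, map_smul, hφ.map_star, hφ.map_one, smul_eq_mul, mul_one,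
    Complex.mul_conj, Complex.add_re, Complex.sub_re] at h
  rw [mul_comm (conj (φ a)), Complex.mul_conj, Complex.ofReal_re, Complex.normSq_eq_norm_sq] at h
  linarith

/-- Positivity in `IsState` is tested only on elements `star b * b`, so the operator inequality `a^*
a ≤ ‖a‖²` is needed in the form of an explicit square. -/
theorem CStarAlgebra.exists_star_mul_self_eq_norm_sq_sub {B : Type*} [CStarAlgebra B] (a : B) :
    ∃ b : B, star b * b = ((‖a‖ ^ 2 : ℝ) : ℂ) • (1 : B) - star a * a := by
  let _ : PartialOrder B := CStarAlgebra.spectralOrder B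
  have _ : StarOrderedRing B := CStarAlgebra.spectralOrderedRing B
  have h := sub_nonneg.2 (CStarAlgebra.star_mul_le_algebraMap_norm_sq (a := a))
  obtain ⟨b, hb⟩ := CStarAlgebra.nonneg_iff_eq_star_mul_self.1 h
  refine ⟨b, ?_⟩
  rw [← hb, Algebra.algebraMap_eq_smul_one, Complex.coe_smul]

/-- States are contractive. -/
theorem IsState.norm_apply_le {φ : CARAlgebra Γ →L[ℂ] ℂ} (hφ : IsState φ) (a : CARAlgebra Γ) :
    ‖φ a‖ ≤ ‖a‖ := by
  obtain ⟨b, hb⟩ := @CStarAlgebra.exists_star_mul_self_eq_norm_sq_sub _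
    (StarSubalgebra.cstarAlgebra (carSubalgebra Γ) (h_closed := isClosed_carSubalgebra)) a
  have h := (Complex.nonneg_iff.1 (hφ.nonneg b)).1
  have h' : φ (star b * b) = ((‖a‖ ^ 2 : ℝ) : ℂ) - φ (star a * a) := by
    refine (congrArg φ hb).trans ?_
    refine (map_sub φ _ _).trans ?_
    refine congrArg₂ _ ?_ rfl
    refine (map_smul φ _ _).trans ?_
    rw [hφ.map_one, smul_eq_mul, mul_one]
  rw [h', Complex.sub_re, Complex.ofReal_re] at h
  have h5 := hφ.normSq_apply_le a
  exact le_of_sq_le_sq (by linarith) (norm_nonneg a)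

/-! ### Matrix units on Fock space -/

theorem carAlgebra_ext {a b : CARAlgebra Γ} (h : ∀ f R, (a.1 f) R = (b.1 f) R) : a = b := by
  apply Subtype.ext
  ext f R
  exact h f R

/-- In the occupation basis a product of distinct annihilators only removes sites and inserts signs.
The value of `σ` is never needed: the same `σ` governs the adjoint, so signs cancel through `σ R * σ
R = 1`. -/
theorem exists_sign_carList_apply (l : List Γ) (hl : l.Nodup) :
    ∃ σ : Finset Γ → ℂ, (∀ R, σ R * σ R = 1) ∧
      (∀ f R, (((l.map carC).prod : CARAlgebra Γ).1 f) R =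
        if Disjoint R l.toFinset then σ R * f (R ∪ l.toFinset) else 0) ∧
      (∀ f R, ((star (l.map carC).prod : CARAlgebra Γ).1 f) R =
        if l.toFinset ⊆ R then σ (R \ l.toFinset) * f (R \ l.toFinset) else 0) := by
  induction l with
  | nil => exact ⟨fun _ => 1, by simp, by simp, by simp⟩
  | cons i l ih =>
    obtain ⟨hi, hl⟩ := List.nodup_cons.1 hl
    obtain ⟨σ, h1, h2, h3⟩ := ih hl
    refine ⟨fun R => fermionSign i R * σ (insert i R), fun R => ?_, fun f R => ?_, fun f R => ?_⟩
    · rw [mul_mul_mul_comm, fermionSign_mul_self, h1, one_mul]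
    · rw [List.map_cons, List.prod_cons]
      change (fockAnnihilate i (((l.map carC).prod : CARAlgebra Γ).1 f)) R = _
      rw [fockAnnihilate_apply, h2, List.toFinset_cons]
      by_cases hiR : i ∈ R
      · simp [hiR]
      · have : Disjoint (insert i R) l.toFinset ↔ Disjoint R (insert i l.toFinset) := by
          rw [Finset.disjoint_insert_left, Finset.disjoint_insert_right]
          simp [hi, hiR]
        rw [if_neg hiR, if_congr this rfl rfl, Finset.insert_union, Finset.union_insert]
        split_ifs <;> ring
    · rw [List.map_cons, List.prod_cons, star_mul]
      change ((star (l.map carC).prod : CARAlgebra Γ).1 (star (fockAnnihilate i) f)) R = _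
      rw [h3, star_fockAnnihilate_apply, List.toFinset_cons]
      have hil : i ∉ l.toFinset := by simpa using hi
      by_cases hiR : i ∈ R
      · by_cases hlR : l.toFinset ⊆ R
        · have he : (R \ l.toFinset).erase i = R \ insert i l.toFinset := by
            ext x; simp only [Finset.mem_erase, Finset.mem_sdiff, Finset.mem_insert]; tauto
          have hins : insert i (R \ insert i l.toFinset) = R \ l.toFinset := by
            rw [← he, Finset.insert_erase (by simp [hiR, hi])]
          have hsg : fermionSign i (R \ l.toFinset) = fermionSign i (R \ insert i l.toFinset) := by
            rw [← hins, fermionSign_insert i i _ (by simp),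
              if_neg (irrefl_of WellOrderingRel i), one_mul]
          rw [if_pos hlR, if_pos (by simp [hiR, hi]), if_pos (Finset.insert_subset hiR hlR), he, hsg]
          change _ = fermionSign i _ * σ (insert i _) * _
          rw [hins]
          ring
        · rw [if_neg hlR, if_neg fun h => hlR ((Finset.subset_insert _ _).trans h)]
      · rw [if_neg (fun h => hiR (Finset.mem_sdiff.1 h).1),
          if_neg fun h : insert i l.toFinset ⊆ R => hiR (h (Finset.mem_insert_self _ _))]
        simp

theorem exists_sign_carMonomial_apply (S : Finset Γ) :
    ∃ σ : Finset Γ → ℂ, (∀ R, σ R * σ R = 1) ∧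
      (∀ f R, ((carMonomial S).1 f) R = if Disjoint R S then σ R * f (R ∪ S) else 0) ∧
      (∀ f R, ((star (carMonomial S)).1 f) R =
        if S ⊆ R then σ (R \ S) * f (R \ S) else 0) := by
  have h := exists_sign_carList_apply S.toList S.nodup_toList
  rw [Finset.toList_toFinset] at h
  exact h

theorem carC_mul_star_apply (i : Γ) (f : FermionFock Γ) (R : Finset Γ) :
    ((carC i * star (carC i)).1 f) R = if i ∈ R then 0 else f R := by
  change (fockAnnihilate i (star (fockAnnihilate i) f)) R = _
  rw [fockAnnihilate_apply, star_fockAnnihilate_apply]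
  by_cases h : i ∈ R
  · simp [h]
  · rw [if_neg h, if_neg h, if_pos (Finset.mem_insert_self _ _), Finset.erase_insert h,
      fermionSign_insert i i _ h, if_neg (irrefl_of WellOrderingRel i), one_mul, ← mul_assoc,
      fermionSign_mul_self, one_mul]

theorem carVacuum_apply (A : Finset Γ) (f : FermionFock Γ) (R : Finset Γ) :
    ((carVacuum A).1 f) R = if Disjoint R A then f R else 0 := by
  have key : ∀ l : List Γ, (((l.map fun i => carC i * star (carC i)).prod : CARAlgebra Γ).1 f) R =
      if Disjoint R l.toFinset then f R else 0 := by
    intro l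
    induction l with
    | nil => simp
    | cons i l ih =>
      rw [List.map_cons, List.prod_cons]
      change ((carC i * star (carC i)).1
        (((l.map fun i => carC i * star (carC i)).prod : CARAlgebra Γ).1 f)) R = _
      rw [carC_mul_star_apply, ih, List.toFinset_cons]
      by_cases h : i ∈ R
      · simp [h]
      · simp [h, Finset.disjoint_insert_right]
  have h := key A.toList
  rw [Finset.toList_toFinset] at h
  exact h

theorem carVacuum_mul_self (A : Finset Γ) : carVacuum A * carVacuum A = carVacuum A := by
  refine carAlgebra_ext fun f R => ?_
  change ((carVacuum A).1 ((carVacuum A).1 f)) R = _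
  rw [carVacuum_apply, carVacuum_apply]
  split_ifs <;> rfl

theorem carVacuum_union (A B : Finset Γ) : carVacuum (A ∪ B) = carVacuum A * carVacuum B := by
  refine carAlgebra_ext fun f R => ?_
  change _ = ((carVacuum A).1 ((carVacuum B).1 f)) R
  rw [carVacuum_apply, carVacuum_apply, carVacuum_apply,
    if_congr Finset.disjoint_union_right rfl rfl, ite_and]

theorem carVacuum_insert (i : Γ) (A : Finset Γ) :
    carVacuum (insert i A) = carC i * star (carC i) * carVacuum A := by
  refine carAlgebra_ext fun f R => ?_
  change _ = ((carC i * star (carC i)).1 ((carVacuum A).1 f)) R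
  rw [carC_mul_star_apply, carVacuum_apply, carVacuum_apply]
  by_cases h : i ∈ R <;> simp [h, Finset.disjoint_insert_right]

theorem star_carVacuum (A : Finset Γ) : star (carVacuum A) = carVacuum A := by
  induction A using Finset.induction_on with
  | empty => simp [carVacuum]
  | insert i A hi ih =>
    have hcomm : carC i * star (carC i) * carVacuum A = carVacuum A * (carC i * star (carC i)) := by
      refine carAlgebra_ext fun f R => ?_
      change ((carC i * star (carC i)).1 ((carVacuum A).1 f)) R =
        ((carVacuum A).1 ((carC i * star (carC i)).1 f)) R
      rw [carC_mul_star_apply, carVacuum_apply, carVacuum_apply, carC_mul_star_apply]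
      split_ifs <;> rfl
    rw [carVacuum_insert, star_mul, ih, star_mul, star_star, hcomm]

theorem carC_mul_carVacuum {i : Γ} {A : Finset Γ} (hi : i ∈ A) : carC i * carVacuum A = 0 := by
  refine carAlgebra_ext fun f R => ?_
  change (fockAnnihilate i ((carVacuum A).1 f)) R = 0
  rw [fockAnnihilate_apply, carVacuum_apply]
  simp [Finset.disjoint_insert_left, hi]

/-- The partial isometry `w_S` with `w_S^* w_T` the matrix unit `(S, T)` of `𝓐(A)`. -/
noncomputable def carFrame (A S : Finset Γ) : CARAlgebra Γ :=
  carVacuum A * carMonomial S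

theorem star_carFrame_mul (A S T : Finset Γ) :
    star (carFrame A T) * carFrame A S = star (carMonomial T) * carVacuum A * carMonomial S := by
  rw [carFrame, carFrame, star_mul, star_carVacuum, mul_assoc, ← mul_assoc (carVacuum A),
    carVacuum_mul_self, mul_assoc]

theorem densityMatrix_apply (I : Finset Γ) (ψ : CARAlgebra Γ →L[ℂ] ℂ) (S T : I.powerset) :
    densityMatrix I ψ S T = ψ (star (carFrame I T.1) * carFrame I S.1) := by
  rw [star_carFrame_mul]
  rfl

/-- Filling `U` in the empty region `A` and then removing `T` returns to the empty configuration on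
`A` only if `T = U`. -/
theorem carFrame_mul_star {A T U : Finset Γ} (hT : T ⊆ A) (hU : U ⊆ A) :
    carFrame A T * star (carFrame A U) = if T = U then carVacuum A else 0 := by
  refine carAlgebra_ext fun f R => ?_
  rw [carFrame, carFrame, star_mul, star_carVacuum]
  change ((carVacuum A).1 ((carMonomial T).1 ((star (carMonomial U)).1 ((carVacuum A).1 f)))) R = _
  by_cases hR : Disjoint R A
  · have hRT := hR.mono_right hT
    have hRU := hR.mono_right hU
    by_cases hTU : T = U
    · subst hTU
      obtain ⟨σ, hσ, h1, h2⟩ := exists_sign_carMonomial_apply T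
      have hRR : (R ∪ T) \ T = R := by
        rw [Finset.union_sdiff_right, Finset.sdiff_eq_self_of_disjoint hRT]
      rw [if_pos rfl, carVacuum_apply, h1, h2, carVacuum_apply, carVacuum_apply, if_pos hR,
        if_pos hRT, if_pos Finset.subset_union_right, hRR, if_pos hR, ← mul_assoc, hσ, one_mul]
    · obtain ⟨σ, -, h1, -⟩ := exists_sign_carMonomial_apply T
      obtain ⟨τ, -, -, h2⟩ := exists_sign_carMonomial_apply U
      rw [if_neg hTU, carVacuum_apply, h1, h2, carVacuum_apply, if_pos hR, if_pos hRT]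
      split_ifs with h3 h4
      · exfalso
        apply hTU
        refine Finset.Subset.antisymm (fun x hx => ?_) fun x hx => ?_
        · by_contra hxU
          exact Finset.disjoint_left.1 h4
            (Finset.mem_sdiff.2 ⟨Finset.mem_union_right _ hx, hxU⟩) (hT hx)
        · exact (Finset.mem_union.1 (h3 hx)).resolve_left
            fun h => Finset.disjoint_left.1 hRU h hx
      · simp
      · simp
  · rw [carVacuum_apply, if_neg hR]
    split_ifs
    · rw [carVacuum_apply, if_neg hR]
    · rfl

/-- Each summand projects onto the configurations `R` with `R ∩ A = S`, and exactly one `S ⊆ A` fits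
a given `R`. -/
theorem sum_star_carFrame_mul (A : Finset Γ) :
    ∑ S ∈ A.powerset, star (carFrame A S) * carFrame A S = 1 := by
  refine carAlgebra_ext fun f R => ?_
  let ev : CARAlgebra Γ →+ ℂ := AddMonoidHom.mk' (fun a => (a.1 f) R) fun a b => rfl
  change ev _ = f R
  have hev : ∀ S ∈ A.powerset, ev (star (carFrame A S) * carFrame A S) =
      if S = R ∩ A then f R else 0 := by
    intro S hS
    obtain ⟨σ, hσ, h1, h2⟩ := exists_sign_carMonomial_apply S
    rw [star_carFrame_mul]
    change ((star (carMonomial S)).1 ((carVacuum A).1 ((carMonomial S).1 f))) R = _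
    rw [h2, carVacuum_apply, h1]
    have hSA := Finset.mem_powerset.1 hS
    by_cases hSR : S = R ∩ A
    · have hsub : S ⊆ R := hSR ▸ Finset.inter_subset_left
      have hdis : Disjoint (R \ S) A := by
        rw [Finset.disjoint_left]
        intro x hx hxA
        rw [Finset.mem_sdiff, hSR, Finset.mem_inter] at hx
        exact hx.2 ⟨hx.1, hxA⟩
      rw [if_pos hSR, if_pos hsub, if_pos hdis, if_pos Finset.sdiff_disjoint,
        Finset.sdiff_union_of_subset hsub, ← mul_assoc, hσ, one_mul]
    · rw [if_neg hSR]
      split_ifs with h3 h4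
      · exfalso
        apply hSR
        refine Finset.Subset.antisymm (Finset.subset_inter h3 hSA) fun x hx => ?_
        by_contra hxS
        exact Finset.disjoint_left.1 h4
          (Finset.mem_sdiff.2 ⟨(Finset.mem_inter.1 hx).1, hxS⟩) (Finset.mem_inter.1 hx).2
      · rename_i h5
        exact absurd Finset.sdiff_disjoint h5
      · simp
      · simp
  rw [map_sum, Finset.sum_congr rfl hev, Finset.sum_ite_eq',
    if_pos (Finset.mem_powerset.2 Finset.inter_subset_right)]

end CARStructure

section CARGraded

variable {Γ : Type*}

open scoped Classical

/-! ### Region algebras and the grading -/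

theorem carC_mul_carC (i j : Γ) : carC i * carC j = -(carC j * carC i) :=
  eq_neg_of_add_eq_zero_left (Subtype.ext (fockAnnihilate_anticomm i j))

theorem star_carC_mul_carC (i j : Γ) :
    star (carC i) * carC j = (if i = j then 1 else 0) - carC j * star (carC i) := by
  rw [eq_sub_iff_add_eq]
  apply Subtype.ext
  refine (fockAnnihilate_star_anticomm i j).trans ?_
  split_ifs <;> rfl

theorem continuous_carGrading : Continuous (carGrading Γ) := by
  refine Continuous.subtype_mk (f := fun a : CARAlgebra Γ => fockParity Γ * a.1 * fockParity Γ) ?_ _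
  exact (continuous_const.mul continuous_subtype_val).mul continuous_const

@[simp] theorem carGrading_carGrading (a : CARAlgebra Γ) : carGrading Γ (carGrading Γ a) = a := by
  apply Subtype.ext
  change fockParity Γ * (fockParity Γ * a.1 * fockParity Γ) * fockParity Γ = a.1
  rw [← mul_assoc, ← mul_assoc, fockParity_mul_self, one_mul, mul_assoc, fockParity_mul_self,
    mul_one]

theorem carC_mem_regionAlgebra {I : Set Γ} {i : Γ} (hi : i ∈ I) : carC i ∈ regionAlgebra I :=
  StarSubalgebra.le_topologicalClosure _ (StarAlgebra.subset_adjoin ℂ _ ⟨i, hi, rfl⟩)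

/-- `N` is not required to be closed under `star`, so the principle applies to `gradedCommutant` and
`rightStabilizer`; the price is checking the creators separately. -/
theorem regionAlgebra_le {I : Set Γ} {N : Subalgebra ℂ (CARAlgebra Γ)}
    (hN : IsClosed (N : Set (CARAlgebra Γ))) (h1 : ∀ i ∈ I, carC i ∈ N)
    (h2 : ∀ i ∈ I, star (carC i) ∈ N) {a : CARAlgebra Γ} (ha : a ∈ regionAlgebra I) : a ∈ N := by
  have hle : ((StarAlgebra.adjoin ℂ (carC '' I) : StarSubalgebra ℂ (CARAlgebra Γ)) :
      Set (CARAlgebra Γ)) ⊆ N := by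
    have : Algebra.adjoin ℂ (carC '' I ∪ star (carC '' I)) ≤ N := by
      refine Algebra.adjoin_le ?_
      rintro x (⟨i, hi, rfl⟩ | ⟨i, hi, hx⟩)
      · exact h1 i hi
      · rw [← star_star x, ← hx]
        exact h2 i hi
    exact this
  exact closure_minimal hle hN ha

theorem regionAlgebra_mono {I J : Set Γ} (h : I ⊆ J) {a : CARAlgebra Γ}
    (ha : a ∈ regionAlgebra I) : a ∈ regionAlgebra J :=
  regionAlgebra_le (N := (regionAlgebra J).toSubalgebra)
    (StarSubalgebra.isClosed_topologicalClosure _)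
    (fun _ hi => carC_mem_regionAlgebra (h hi))
    (fun i hi => show star (carC i) ∈ regionAlgebra J from
      star_mem (carC_mem_regionAlgebra (h hi))) ha

/-- One closure is taken among all operators on Fock space, the other inside the CAR algebra; the
norm is the same, so approximants transfer. -/
theorem mem_regionAlgebra_univ (a : CARAlgebra Γ) : a ∈ regionAlgebra (Set.univ : Set Γ) := by
  have key : ∀ x (_ : x ∈ StarAlgebra.adjoin ℂ (Set.range (fockAnnihilate (Γ := Γ)))),
      ∃ b ∈ regionAlgebra (Set.univ : Set Γ), b.1 = x := by
    intro x hx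
    induction hx using StarAlgebra.adjoin_induction with
    | mem x h =>
      obtain ⟨i, rfl⟩ := h
      exact ⟨carC i, carC_mem_regionAlgebra (Set.mem_univ i), rfl⟩
    | algebraMap r => exact ⟨algebraMap ℂ _ r, algebraMap_mem _ r, rfl⟩
    | add x y _ _ hx hy =>
      obtain ⟨b, hb, rfl⟩ := hx
      obtain ⟨c, hc, rfl⟩ := hy
      exact ⟨b + c, add_mem hb hc, rfl⟩
    | mul x y _ _ hx hy =>
      obtain ⟨b, hb, rfl⟩ := hx
      obtain ⟨c, hc, rfl⟩ := hy
      exact ⟨b * c, mul_mem hb hc, rfl⟩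
    | star x _ hx =>
      obtain ⟨b, hb, rfl⟩ := hx
      exact ⟨star b, star_mem hb, rfl⟩
  have hcl : IsClosed (regionAlgebra (Set.univ : Set Γ) : Set (CARAlgebra Γ)) :=
    StarSubalgebra.isClosed_topologicalClosure _
  have hmem : a.1 ∈ closure ((StarAlgebra.adjoin ℂ (Set.range (fockAnnihilate (Γ := Γ))) :
      StarSubalgebra ℂ _) : Set (FermionFock Γ →L[ℂ] FermionFock Γ)) := a.2
  change a ∈ (regionAlgebra (Set.univ : Set Γ) : Set (CARAlgebra Γ))
  rw [← hcl.closure_eq, Metric.mem_closure_iff]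
  intro ε hε
  obtain ⟨x, hx, hxε⟩ := Metric.mem_closure_iff.1 hmem ε hε
  obtain ⟨b, hb, rfl⟩ := key x hx
  exact ⟨b, hb, hxε⟩

theorem carGrading_mem_regionAlgebra {I : Set Γ} {a : CARAlgebra Γ} (ha : a ∈ regionAlgebra I) :
    carGrading Γ a ∈ regionAlgebra I := by
  refine regionAlgebra_le
    (N := (regionAlgebra I).toSubalgebra.comap (carGrading Γ).toAlgHom) ?_ ?_ ?_ ha
  · exact (StarSubalgebra.isClosed_topologicalClosure _).preimage continuous_carGrading
  · intro i hi
    change carGrading Γ (carC i) ∈ regionAlgebra I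
    rw [carGrading_carC]
    exact neg_mem (carC_mem_regionAlgebra hi)
  · intro i hi
    change carGrading Γ (star (carC i)) ∈ regionAlgebra I
    rw [map_star, carGrading_carC]
    exact star_mem (neg_mem (carC_mem_regionAlgebra hi))

theorem iterate_carGrading_mem_regionAlgebra {I : Set Γ} {a : CARAlgebra Γ}
    (ha : a ∈ regionAlgebra I) (n : ℕ) : (carGrading Γ)^[n] a ∈ regionAlgebra I := by
  induction n with
  | zero => exact ha
  | succ n ih =>
    rw [Function.iterate_succ_apply']
    exact carGrading_mem_regionAlgebra ih

/-- The elements that commute with `x` up to the grading. -/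
noncomputable def gradedCommutant (x : CARAlgebra Γ) : Subalgebra ℂ (CARAlgebra Γ) where
  carrier := {b | x * b = carGrading Γ b * x}
  mul_mem' {a b} ha hb := by
    change x * (a * b) = carGrading Γ (a * b) * x
    rw [← mul_assoc, show x * a = _ from ha, mul_assoc, show x * b = _ from hb, map_mul, mul_assoc]
  add_mem' {a b} ha hb := by
    change x * (a + b) = carGrading Γ (a + b) * x
    rw [mul_add, show x * a = _ from ha, show x * b = _ from hb, map_add, add_mul]
  algebraMap_mem' r := by
    change x * algebraMap ℂ _ r = carGrading Γ (algebraMap ℂ _ r) * x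
    rw [AlgHomClass.commutes, Algebra.commutes]

theorem isClosed_gradedCommutant (x : CARAlgebra Γ) :
    IsClosed (gradedCommutant x : Set (CARAlgebra Γ)) := by
  have h1 : Continuous fun b : CARAlgebra Γ => x * b := continuous_const_mul x
  have h2 : Continuous fun b : CARAlgebra Γ => carGrading Γ b * x :=
    (continuous_mul_const x).comp continuous_carGrading
  exact isClosed_eq h1 h2

/-- On generators this is the anticommutation relation, and the relation is preserved by products,
sums and limits in `b`. -/
theorem carC_mul_of_mem {I : Set Γ} {i : Γ} (hi : i ∉ I) {b : CARAlgebra Γ}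
    (hb : b ∈ regionAlgebra I) : carC i * b = carGrading Γ b * carC i := by
  refine regionAlgebra_le (isClosed_gradedCommutant (carC i)) (fun j _ => ?_) (fun j hj => ?_) hb
  · change carC i * carC j = carGrading Γ (carC j) * carC i
    rw [carGrading_carC, carC_mul_carC, neg_mul]
  · change carC i * star (carC j) = carGrading Γ (star (carC j)) * carC i
    have hji : j ≠ i := fun h => hi (h ▸ hj)
    rw [map_star, carGrading_carC, star_neg, neg_mul, star_carC_mul_carC, if_neg hji, zero_sub,
      neg_neg]

/-- `x` commutes with all `b ∈ 𝓐(I)` up to the `n`-th power of the grading. -/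
def GradedCommute (I : Set Γ) (n : ℕ) (x : CARAlgebra Γ) : Prop :=
  ∀ b ∈ regionAlgebra I, x * b = (carGrading Γ)^[n] b * x

theorem iterate_carGrading_iterate (n : ℕ) (a : CARAlgebra Γ) :
    (carGrading Γ)^[n] ((carGrading Γ)^[n] a) = a := by
  have h : Function.Involutive (carGrading Γ) := carGrading_carGrading
  rw [← Function.iterate_add_apply, ← two_mul, h.iterate_two_mul, id]

theorem iterate_carGrading_mul (n : ℕ) (a b : CARAlgebra Γ) :
    (carGrading Γ)^[n] (a * b) = (carGrading Γ)^[n] a * (carGrading Γ)^[n] b :=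
  iterate_map_mul (carGrading Γ) n a b

theorem iterate_carGrading_star (n : ℕ) (a : CARAlgebra Γ) :
    (carGrading Γ)^[n] (star a) = star ((carGrading Γ)^[n] a) := by
  induction n with
  | zero => rfl
  | succ n ih => rw [Function.iterate_succ_apply', ih, map_star, Function.iterate_succ_apply']

theorem iterate_carGrading_of_eq_smul {s : ℂ} {a : CARAlgebra Γ} (h : carGrading Γ a = s • a)
    (n : ℕ) : (carGrading Γ)^[n] a = s ^ n • a := by
  induction n with
  | zero => simp
  | succ n ih => rw [Function.iterate_succ_apply', ih, map_smul, h, smul_smul, pow_succ]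

theorem GradedCommute.mul {I : Set Γ} {n m : ℕ} {x y : CARAlgebra Γ} (hx : GradedCommute I n x)
    (hy : GradedCommute I m y) : GradedCommute I (n + m) (x * y) := by
  intro b hb
  rw [mul_assoc, hy b hb, ← mul_assoc, hx _ (iterate_carGrading_mem_regionAlgebra hb m), mul_assoc,
    Function.iterate_add_apply]

/-- The form of graded commutation that moves `x` to the left. -/
theorem GradedCommute.mul_eq {I : Set Γ} {n : ℕ} {x : CARAlgebra Γ} (hx : GradedCommute I n x)
    {b : CARAlgebra Γ} (hb : b ∈ regionAlgebra I) : b * x = x * (carGrading Γ)^[n] b := by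
  rw [hx _ (iterate_carGrading_mem_regionAlgebra hb n), iterate_carGrading_iterate]

theorem GradedCommute.star {I : Set Γ} {n : ℕ} {x : CARAlgebra Γ} (hx : GradedCommute I n x) :
    GradedCommute I n (star x) := by
  intro b hb
  have h := congrArg Star.star (hx.mul_eq (star_mem hb))
  rwa [star_mul, star_mul, star_star, iterate_carGrading_star, star_star] at h

theorem gradedCommute_carC {I : Set Γ} {i : Γ} (hi : i ∉ I) : GradedCommute I 1 (carC i) :=
  fun _ hb => carC_mul_of_mem hi hb

theorem gradedCommute_carC_mul_star {I : Set Γ} {i : Γ} (hi : i ∉ I) :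
    GradedCommute I 0 (carC i * Star.star (carC i)) := by
  intro b hb
  rw [(gradedCommute_carC hi).mul (gradedCommute_carC hi).star b hb]
  simp

theorem gradedCommute_carVacuum {I : Set Γ} {A : Finset Γ} (h : Disjoint (A : Set Γ) I) :
    GradedCommute I 0 (carVacuum A) := by
  induction A using Finset.induction_on with
  | empty => intro b hb; simp [carVacuum]
  | insert i A hi ih =>
    rw [carVacuum_insert]
    rw [Finset.coe_insert, Set.disjoint_insert_left] at h
    exact (gradedCommute_carC_mul_star h.1).mul (ih h.2)

theorem gradedCommute_carMonomial {I : Set Γ} {S : Finset Γ} (h : Disjoint (S : Set Γ) I) :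
    GradedCommute I S.card (carMonomial S) := by
  have key : ∀ l : List Γ, (∀ i ∈ l, i ∉ I) → GradedCommute I l.length (l.map carC).prod := by
    intro l hl
    induction l with
    | nil => intro b hb; simp
    | cons i l ih =>
      rw [List.map_cons, List.prod_cons, List.length_cons, add_comm]
      exact (gradedCommute_carC (hl i (by simp))).mul (ih fun j hj => hl j (by simp [hj]))
  have h' := key S.toList fun i hi => Set.disjoint_left.1 h (by simpa using hi)
  rwa [Finset.length_toList] at h'

theorem gradedCommute_carFrame {I : Set Γ} {A S : Finset Γ} (h : Disjoint (A : Set Γ) I)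
    (hS : S ⊆ A) : GradedCommute I S.card (carFrame A S) := by
  have := (gradedCommute_carVacuum h).mul
    (gradedCommute_carMonomial (h.mono_left (Finset.coe_subset.2 hS)))
  rwa [zero_add] at this

theorem carMonomial_mem_regionAlgebra (S : Finset Γ) : carMonomial S ∈ regionAlgebra (S : Set Γ) :=
  list_prod_mem fun x hx => by
    obtain ⟨i, hi, rfl⟩ := List.mem_map.1 hx
    exact carC_mem_regionAlgebra (by simpa using hi)

theorem carVacuum_mem_regionAlgebra (A : Finset Γ) : carVacuum A ∈ regionAlgebra (A : Set Γ) :=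
  list_prod_mem fun x hx => by
    obtain ⟨i, hi, rfl⟩ := List.mem_map.1 hx
    have : carC i ∈ regionAlgebra (A : Set Γ) := carC_mem_regionAlgebra (by simpa using hi)
    exact mul_mem this (star_mem this)

theorem carFrame_mem_regionAlgebra {A S : Finset Γ} (hS : S ⊆ A) :
    carFrame A S ∈ regionAlgebra (A : Set Γ) :=
  mul_mem (carVacuum_mem_regionAlgebra A)
    (regionAlgebra_mono (Finset.coe_subset.2 hS) (carMonomial_mem_regionAlgebra S))

theorem carGrading_carMonomial (S : Finset Γ) :
    carGrading Γ (carMonomial S) = (-1 : ℂ) ^ S.card • carMonomial S := by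
  have key : ∀ l : List Γ, carGrading Γ (l.map carC).prod =
      (-1 : ℂ) ^ l.length • (l.map carC).prod := by
    intro l
    induction l with
    | nil => simp
    | cons i l ih =>
      rw [List.map_cons, List.prod_cons, map_mul, ih, carGrading_carC, List.length_cons, pow_succ,
        mul_smul, neg_one_smul, neg_mul, mul_smul_comm, smul_neg]
  have h := key S.toList
  rwa [Finset.length_toList] at h

theorem carGrading_carVacuum (A : Finset Γ) : carGrading Γ (carVacuum A) = carVacuum A := by
  induction A using Finset.induction_on with
  | empty => simp [carVacuum]
  | insert i A hi ih =>
    rw [carVacuum_insert, map_mul, map_mul, map_star, ih, carGrading_carC, star_neg, neg_mul_neg]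

theorem carGrading_carFrame (A S : Finset Γ) :
    carGrading Γ (carFrame A S) = (-1 : ℂ) ^ S.card • carFrame A S := by
  rw [carFrame, map_mul, carGrading_carVacuum, carGrading_carMonomial, mul_smul_comm]

/-! ### Reordering monomials -/

/-- Monomials are ordered by `Finset.toList`, which is not compatible with unions; reordering costs
only a sign. -/
theorem List.Perm.exists_sign_prod_carC {l l' : List Γ} (h : l.Perm l') :
    ∃ ε : ℂ, (ε = 1 ∨ ε = -1) ∧ (l.map carC).prod = ε • (l'.map carC).prod := by
  induction h with
  | nil => exact ⟨1, Or.inl rfl, by simp⟩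
  | cons i _ ih =>
    obtain ⟨ε, hε, h⟩ := ih
    exact ⟨ε, hε, by simp only [List.map_cons, List.prod_cons, h, mul_smul_comm]⟩
  | swap i j l =>
    refine ⟨-1, Or.inr rfl, ?_⟩
    simp only [List.map_cons, List.prod_cons]
    rw [← mul_assoc, carC_mul_carC, neg_mul, mul_assoc, neg_one_smul]
  | trans _ _ ih₁ ih₂ =>
    obtain ⟨ε₁, h₁, h₁'⟩ := ih₁
    obtain ⟨ε₂, h₂, h₂'⟩ := ih₂
    refine ⟨ε₁ * ε₂, ?_, by rw [h₁', h₂', smul_smul]⟩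
    rcases h₁ with rfl | rfl <;> rcases h₂ with rfl | rfl <;> simp

theorem exists_sign_carMonomial_union {S T : Finset Γ} (h : Disjoint S T) :
    ∃ ε : ℂ, (ε = 1 ∨ ε = -1) ∧ carMonomial (S ∪ T) = ε • (carMonomial S * carMonomial T) := by
  have hperm : (S ∪ T).toList.Perm (S.toList ++ T.toList) := by
    rw [List.perm_ext_iff_of_nodup (Finset.nodup_toList _)]
    · simp
    · rw [List.nodup_append]
      refine ⟨S.nodup_toList, T.nodup_toList, fun x hx y hy hxy => ?_⟩
      subst hxy
      exact Finset.disjoint_left.1 h (by simpa using hx) (by simpa using hy)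
  obtain ⟨ε, hε, h'⟩ := hperm.exists_sign_prod_carC
  exact ⟨ε, hε, by rw [carMonomial, h', List.map_append, List.prod_append]; rfl⟩

theorem carMonomial_singleton (i : Γ) : carMonomial {i} = carC i := by
  simp [carMonomial]

theorem exists_sign_carMonomial_insert {S : Finset Γ} {i : Γ} (hi : i ∉ S) :
    ∃ ε : ℂ, (ε = 1 ∨ ε = -1) ∧ carMonomial (insert i S) = ε • (carMonomial S * carC i) := by
  have h := exists_sign_carMonomial_union (Finset.disjoint_singleton_right.2 hi)
  rwa [carMonomial_singleton, Finset.union_comm, ← Finset.insert_eq] at h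

theorem exists_sign_carFrame_union {A B S T : Finset Γ} (hAB : Disjoint A B) (hS : S ⊆ A)
    (hT : T ⊆ B) : ∃ ε : ℂ, (ε = 1 ∨ ε = -1) ∧
      carFrame (A ∪ B) (S ∪ T) = ε • (carFrame A S * carFrame B T) := by
  obtain ⟨ε, hε, h⟩ := exists_sign_carMonomial_union (hAB.mono hS hT)
  refine ⟨ε, hε, ?_⟩
  have hcomm : carVacuum B * carMonomial S = carMonomial S * carVacuum B := by
    rw [(gradedCommute_carVacuum (A := B) (I := (A : Set Γ)) (by
      exact_mod_cast hAB.symm)) _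
      (regionAlgebra_mono (Finset.coe_subset.2 hS) (carMonomial_mem_regionAlgebra S))]
    rfl
  rw [carFrame, carFrame, carFrame, h, carVacuum_union, mul_smul_comm]
  congr 1
  rw [mul_assoc, mul_assoc, ← mul_assoc (carVacuum B), hcomm, mul_assoc]

/-! ### The frame spans the local algebra -/

/-- The elements that map a subspace into itself by multiplication from the right. -/
def rightStabilizer (W : Submodule ℂ (CARAlgebra Γ)) : Subalgebra ℂ (CARAlgebra Γ) where
  carrier := {a | ∀ w ∈ W, w * a ∈ W}
  mul_mem' {a b} ha hb w hw := by
    rw [← mul_assoc]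
    exact hb _ (ha w hw)
  add_mem' {a b} ha hb w hw := by
    rw [mul_add]
    exact add_mem (ha w hw) (hb w hw)
  algebraMap_mem' r w hw := by
    rw [Algebra.algebraMap_eq_smul_one, mul_smul_comm, mul_one]
    exact W.smul_mem r hw

theorem isClosed_rightStabilizer {W : Submodule ℂ (CARAlgebra Γ)}
    (hW : IsClosed (W : Set (CARAlgebra Γ))) :
    IsClosed (rightStabilizer W : Set (CARAlgebra Γ)) := by
  have : (rightStabilizer W : Set (CARAlgebra Γ)) =
      ⋂ w ∈ W, (fun a => w * a) ⁻¹' (W : Set (CARAlgebra Γ)) := by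
    ext a
    simp only [Set.mem_iInter]
    rfl
  rw [this]
  exact isClosed_biInter fun w _ => hW.preimage (continuous_const.mul continuous_id)

theorem star_carC_mul_carMonomial {S : Finset Γ} {i : Γ} (hi : i ∉ S) :
    ∃ c : ℂ, carMonomial S * star (carC i) = c • (star (carC i) * carMonomial S) := by
  refine ⟨(-1) ^ S.card, ?_⟩
  have h := gradedCommute_carMonomial (S := S) (I := {i}) (by simpa using hi) _
    (star_mem (carC_mem_regionAlgebra (Set.mem_singleton i)))
  rw [h, iterate_carGrading_of_eq_smul (s := -1) (by
    rw [map_star, carGrading_carC, star_neg, neg_one_smul]), smul_mul_assoc]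

theorem carVacuum_mul_star_carC {i : Γ} {A : Finset Γ} (hi : i ∈ A) :
    carVacuum A * star (carC i) = 0 := by
  have h := congrArg star (carC_mul_carVacuum hi)
  rwa [star_mul, star_carVacuum, star_zero] at h

/-- Right multiplication of `w_S` by an annihilator adds a site to `S` or gives zero; by a creator
it removes a site or gives zero. The span is finite-dimensional, hence closed, so stability passes
from generators to the closure. -/
theorem carFrame_mul_mem_span {A : Finset Γ} {a w : CARAlgebra Γ}
    (ha : a ∈ regionAlgebra (A : Set Γ))
    (hw : w ∈ Submodule.span ℂ (carFrame A '' (A.powerset : Set (Finset Γ)))) :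
    w * a ∈ Submodule.span ℂ (carFrame A '' (A.powerset : Set (Finset Γ))) := by
  set W := Submodule.span ℂ (carFrame A '' (A.powerset : Set (Finset Γ))) with hWdef
  have hfin : FiniteDimensional ℂ W :=
    FiniteDimensional.span_of_finite ℂ ((Finset.finite_toSet _).image _)
  have hcl : IsClosed (W : Set (CARAlgebra Γ)) := Submodule.closed_of_finiteDimensional W
  have hmem : ∀ S, S ⊆ A → carFrame A S ∈ W := fun S hS =>
    Submodule.subset_span ⟨S, by simpa using hS, rfl⟩
  have hgen : ∀ x : CARAlgebra Γ, (∀ S, S ⊆ A → carFrame A S * x ∈ W) → x ∈ rightStabilizer W := by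
    intro x hx v hv
    induction hv using Submodule.span_induction with
    | mem v hv =>
      obtain ⟨S, hS, rfl⟩ := hv
      exact hx S (by simpa using hS)
    | zero => rw [zero_mul]; exact zero_mem _
    | add u v _ _ hu hv => rw [add_mul]; exact add_mem hu hv
    | smul r v _ hv => rw [smul_mul_assoc]; exact W.smul_mem r hv
  refine regionAlgebra_le (isClosed_rightStabilizer hcl) (fun i hi => hgen _ fun S hS => ?_)
    (fun i hi => hgen _ fun S hS => ?_) ha w hw
  · by_cases hiS : i ∈ S
    · obtain ⟨ε, -, h⟩ := exists_sign_carMonomial_insert (Finset.notMem_erase i S)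
      rw [Finset.insert_erase hiS] at h
      have h0 : carC i * carC i = 0 := by
        have h2 : (2 : ℂ) • (carC i * carC i) = 0 := by
          rw [two_smul]
          nth_rewrite 1 [carC_mul_carC i i]
          exact neg_add_cancel _
        have h3 := congrArg (fun x : CARAlgebra Γ => (2⁻¹ : ℂ) • x) h2
        simpa only [smul_smul, inv_mul_cancel₀ (two_ne_zero' ℂ), one_smul, smul_zero] using h3
      rw [carFrame, h, mul_assoc, smul_mul_assoc, mul_assoc, h0, mul_zero, smul_zero, mul_zero]
      exact zero_mem _
    · obtain ⟨ε, hε, h⟩ := exists_sign_carMonomial_insert hiS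
      have hεε : ε * ε = 1 := by rcases hε with rfl | rfl <;> simp
      have : carFrame A S * carC i = ε • carFrame A (insert i S) := by
        rw [carFrame, carFrame, h, mul_smul_comm, smul_smul, hεε, one_smul, mul_assoc]
      rw [this]
      exact W.smul_mem _ (hmem _ (Finset.insert_subset hi hS))
  · by_cases hiS : i ∈ S
    · obtain ⟨ε, -, h⟩ := exists_sign_carMonomial_insert (Finset.notMem_erase i S)
      rw [Finset.insert_erase hiS] at h
      obtain ⟨c, hc⟩ := star_carC_mul_carMonomial (Finset.notMem_erase i S)
      -- The `1` gives the shorter monomial; in the other term the creator moves left until the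
      -- vacuum projection kills it.
      have h1 : carC i * star (carC i) = 1 - star (carC i) * carC i := by
        rw [star_carC_mul_carC, if_pos rfl, sub_sub_cancel]
      have : carFrame A S * star (carC i) = ε • carFrame A (S.erase i) := by
        rw [carFrame, carFrame, h, mul_smul_comm, smul_mul_assoc, mul_assoc, mul_assoc, h1, mul_sub,
          mul_one, mul_sub, ← mul_assoc (carMonomial _), hc, smul_mul_assoc, mul_smul_comm,
          ← mul_assoc, ← mul_assoc, carVacuum_mul_star_carC hi, zero_mul, zero_mul, smul_zero,
          sub_zero]
      rw [this]
      exact W.smul_mem _ (hmem _ ((Finset.erase_subset i S).trans hS))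
    · obtain ⟨c, hc⟩ := star_carC_mul_carMonomial hiS
      rw [carFrame, mul_assoc, hc, mul_smul_comm, ← mul_assoc, carVacuum_mul_star_carC hi, zero_mul,
        smul_zero]
      exact zero_mem _

/-- The matrix units of `𝓐(A)`. -/
noncomputable def carUnit (A S T : Finset Γ) : CARAlgebra Γ :=
  star (carFrame A S) * carFrame A T

/-- Insert the resolution `∑ w_S^* w_S = 1` on the left of `a` and expand each row `w_S a` in the
frame. -/
theorem mem_span_carUnit {A : Finset Γ} {a : CARAlgebra Γ} (ha : a ∈ regionAlgebra (A : Set Γ)) :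
    a ∈ Submodule.span ℂ {x | ∃ S ⊆ A, ∃ T ⊆ A, x = carUnit A S T} := by
  have h : a = ∑ S ∈ A.powerset, star (carFrame A S) * (carFrame A S * a) := by
    simp only [← mul_assoc, ← Finset.sum_mul, sum_star_carFrame_mul, one_mul]
  rw [h]
  refine sum_mem fun S hS => ?_
  have hS' := Finset.mem_powerset.1 hS
  have hw := carFrame_mul_mem_span ha (Submodule.subset_span ⟨S, by simpa using hS', rfl⟩)
  generalize carFrame A S * a = w at hw
  induction hw using Submodule.span_induction with
  | mem v hv =>
    obtain ⟨T, hT, rfl⟩ := hv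
    exact Submodule.subset_span ⟨S, hS', T, by simpa using hT, rfl⟩
  | zero => rw [mul_zero]; exact zero_mem _
  | add u v _ _ hu hv => rw [mul_add]; exact add_mem hu hv
  | smul r v _ hv => rw [mul_smul_comm]; exact Submodule.smul_mem _ r hv

theorem carUnit_mul_carUnit {A S T U V : Finset Γ} (hT : T ⊆ A) (hU : U ⊆ A) :
    carUnit A S T * carUnit A U V = if T = U then carUnit A S V else 0 := by
  rw [carUnit, carUnit, mul_assoc, ← mul_assoc (carFrame A T), carFrame_mul_star hT hU]
  split_ifs
  · rw [carUnit, carFrame, carFrame, ← mul_assoc (carVacuum A), carVacuum_mul_self]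
  · rw [zero_mul, mul_zero]

theorem star_carUnit (A S T : Finset Γ) : star (carUnit A S T) = carUnit A T S := by
  rw [carUnit, star_mul, star_star, carUnit]

theorem gradedCommute_carUnit {I : Set Γ} {A S T : Finset Γ} (h : Disjoint (A : Set Γ) I)
    (hS : S ⊆ A) (hT : T ⊆ A) : GradedCommute I (S.card + T.card) (carUnit A S T) :=
  (gradedCommute_carFrame h hS).star.mul (gradedCommute_carFrame h hT)

theorem carUnit_mem_regionAlgebra {A S T : Finset Γ} (hS : S ⊆ A) (hT : T ⊆ A) :
    carUnit A S T ∈ regionAlgebra (A : Set Γ) :=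
  mul_mem (star_mem (carFrame_mem_regionAlgebra hS)) (carFrame_mem_regionAlgebra hT)

theorem carGrading_carUnit (A S T : Finset Γ) :
    carGrading Γ (carUnit A S T) = (-1 : ℂ) ^ (S.card + T.card) • carUnit A S T := by
  rw [carUnit, map_mul, map_star, carGrading_carFrame, carGrading_carFrame, star_smul,
    smul_mul_smul_comm, pow_add]
  simp

end CARGraded

section CARProduct

variable {Γ : Type*}

open scoped Classical

/-! ### Density matrices of states -/

theorem densityMatrix_eq_carUnit (I : Finset Γ) (ψ : CARAlgebra Γ →L[ℂ] ℂ) (S T : I.powerset) :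
    densityMatrix I ψ S T = ψ (carUnit I T.1 S.1) :=
  densityMatrix_apply I ψ S T

theorem IsState.isHermitian_densityMatrix {ψ : CARAlgebra Γ →L[ℂ] ℂ} (hψ : IsState ψ)
    (I : Finset Γ) : (densityMatrix I ψ).IsHermitian := by
  ext S T
  rw [Matrix.conjTranspose_apply, densityMatrix_eq_carUnit, densityMatrix_eq_carUnit,
    RCLike.star_def, ← hψ.map_star, star_carUnit]

/-- The density matrix is a Gram matrix of the frame: its quadratic form at `v` is `ψ (x^* x)` with
`x = ∑ conj (v S) • w_S`. -/
theorem IsState.posSemidef_densityMatrix {ψ : CARAlgebra Γ →L[ℂ] ℂ} (hψ : IsState ψ)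
    (I : Finset Γ) : (densityMatrix I ψ).PosSemidef := by
  refine .of_dotProduct_mulVec_nonneg (hψ.isHermitian_densityMatrix I) fun v => ?_
  have h := hψ.nonneg (∑ S : I.powerset, conj (v S) • carFrame I S.1)
  have heq : star v ⬝ᵥ (densityMatrix I ψ).mulVec v =
      ψ (star (∑ S : I.powerset, conj (v S) • carFrame I S.1) *
        ∑ S : I.powerset, conj (v S) • carFrame I S.1) := by
    simp only [dotProduct, Matrix.mulVec, densityMatrix_apply, star_sum, star_smul, Finset.sum_mul,
      Finset.mul_sum, map_sum, smul_mul_smul_comm, map_smul, smul_eq_mul, RCLike.star_def,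
      Complex.conj_conj, Pi.star_apply]
    refine Finset.sum_congr rfl fun T _ => Finset.sum_congr rfl fun S _ => ?_
    ring
  rwa [heq]

theorem IsState.trace_densityMatrix {ψ : CARAlgebra Γ →L[ℂ] ℂ} (hψ : IsState ψ)
    (I : Finset Γ) : (densityMatrix I ψ).trace = 1 := by
  rw [Matrix.trace]
  simp only [Matrix.diag_apply, densityMatrix_apply]
  rw [← map_sum, Finset.sum_coe_sort I.powerset fun S => star (carFrame I S) * carFrame I S,
    sum_star_carFrame_mul, hψ.map_one]

theorem Matrix.PosSemidef.exists_eq_conjTranspose_mul_self {n : Type*} [Fintype n]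
    {M : Matrix n n ℂ} (hM : M.PosSemidef) : ∃ B : Matrix n n ℂ, M = B.conjTranspose * B := by
  open MatrixOrder in
  exact CStarAlgebra.nonneg_iff_eq_star_mul_self.1 hM.nonneg

/-! ### The product-state extension -/

/-- The functional `x ↦ ∑ φ(E_ST) φ(x_ST)`, where `x_ST = ∑_R E_RS x E_TR` are the components of
`x` in the commutant of `𝓐(A)`. -/
noncomputable def carProduct (A : Finset Γ) (φ : CARAlgebra Γ →L[ℂ] ℂ) : CARAlgebra Γ →L[ℂ] ℂ :=
  ∑ R : A.powerset, ∑ S : A.powerset, ∑ T : A.powerset, φ (carUnit A S.1 T.1) •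
    φ.comp (ContinuousLinearMap.mulLeftRight ℂ (CARAlgebra Γ) (carUnit A R.1 S.1)
      (carUnit A T.1 R.1))

theorem carProduct_apply (A : Finset Γ) (φ : CARAlgebra Γ →L[ℂ] ℂ) (x : CARAlgebra Γ) :
    carProduct A φ x = ∑ R : A.powerset, ∑ S : A.powerset, ∑ T : A.powerset,
      φ (carUnit A S.1 T.1) * φ (carUnit A R.1 S.1 * x * carUnit A T.1 R.1) := by
  simp only [carProduct, sum_apply, smul_apply,
    smul_eq_mul, ContinuousLinearMap.comp_apply, ContinuousLinearMap.mulLeftRight_apply]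

/-- Writing the density matrix as `B^* B` turns the double sum over `S, T`, for each fixed `R`, into
a sum over `k` of values of `φ` on squares. -/
theorem IsState.carProduct_nonneg {φ : CARAlgebra Γ →L[ℂ] ℂ} (hφ : IsState φ) (A : Finset Γ)
    (x : CARAlgebra Γ) : 0 ≤ carProduct A φ (star x * x) := by
  obtain ⟨B, hB⟩ := (hφ.posSemidef_densityMatrix A).exists_eq_conjTranspose_mul_self
  rw [carProduct_apply]
  refine Finset.sum_nonneg fun R _ => ?_
  have key : ∑ S : A.powerset, ∑ T : A.powerset, φ (carUnit A S.1 T.1) *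
        φ (carUnit A R.1 S.1 * (star x * x) * carUnit A T.1 R.1) =
      ∑ k, φ (star (∑ T : A.powerset, conj (B k T) • (x * carUnit A T.1 R.1)) *
        ∑ T : A.powerset, conj (B k T) • (x * carUnit A T.1 R.1)) := by
    have hE : ∀ S T : A.powerset, φ (carUnit A S.1 T.1) = ∑ k, B k S * conj (B k T) := by
      intro S T
      rw [← densityMatrix_eq_carUnit, hB, Matrix.mul_apply]
      refine Finset.sum_congr rfl fun k _ => ?_
      rw [Matrix.conjTranspose_apply, mul_comm, RCLike.star_def]
    simp only [hE, star_sum, star_smul, Finset.sum_mul, Finset.mul_sum, map_sum, star_mul,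
      star_carUnit, smul_mul_smul_comm, map_smul, smul_eq_mul, RCLike.star_def, Complex.conj_conj,
      mul_assoc]
    rw [Finset.sum_comm]
    conv_rhs => rw [Finset.sum_comm]
    exact Finset.sum_congr rfl fun T _ => Finset.sum_comm
  rw [key]
  exact Finset.sum_nonneg fun k _ => hφ.nonneg _

theorem IsEvenState.apply_iterate_carGrading {φ : CARAlgebra Γ →L[ℂ] ℂ} (hφ : IsEvenState φ)
    (n : ℕ) (a : CARAlgebra Γ) : φ ((carGrading Γ)^[n] a) = φ a := by
  induction n with
  | zero => rfl
  | succ n ih => rw [Function.iterate_succ_apply', hφ, ih]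

/-- The matrix-unit relations leave only `S = U`, `T = V`; the remaining sum over `R` of `φ (E_RR
b)` is `φ b`. -/
theorem carProduct_carUnit_mul {φ : CARAlgebra Γ →L[ℂ] ℂ} (he : IsEvenState φ)
    {A U V : Finset Γ} (hU : U ⊆ A) (hV : V ⊆ A) {b : CARAlgebra Γ}
    (hb : b ∈ regionAlgebra (A : Set Γ)ᶜ) :
    carProduct A φ (carUnit A U V * b) = φ (carUnit A U V) * φ b := by
  rw [carProduct_apply]
  have hterm : ∀ R S T : A.powerset, φ (carUnit A S.1 T.1) *
      φ (carUnit A R.1 S.1 * (carUnit A U V * b) * carUnit A T.1 R.1) =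
      if T = ⟨V, Finset.mem_powerset.2 hV⟩ then
        if S = ⟨U, Finset.mem_powerset.2 hU⟩ then φ (carUnit A U V) * φ (carUnit A R.1 R.1 * b)
        else 0
      else 0 := by
    rintro ⟨R, hR⟩ ⟨S, hS⟩ ⟨T, hT⟩
    rw [Finset.mem_powerset] at hR hS hT
    simp only [Subtype.mk.injEq]
    rw [← mul_assoc, carUnit_mul_carUnit hS hU]
    by_cases hSU : S = U
    · rw [if_pos hSU, if_pos hSU, mul_assoc,
        (gradedCommute_carUnit disjoint_compl_right hT hR).mul_eq hb, ← mul_assoc,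
        carUnit_mul_carUnit hV hT]
      by_cases hTV : T = V
      · subst hTV hSU
        -- Moving `b` past `E_TR` has applied a power of the grading to it. Evenness of `φ` undoes
        -- this, since `E_RR` is itself even.
        rw [if_pos rfl, if_pos rfl, ← he.apply_iterate_carGrading (T.card + R.card) (_ * b),
          iterate_carGrading_mul, iterate_carGrading_of_eq_smul (carGrading_carUnit A R R),
          Even.neg_one_pow ⟨_, rfl⟩, one_pow, one_smul]
      · rw [if_neg hTV, if_neg fun h => hTV h.symm, zero_mul, map_zero, mul_zero]
    · rw [if_neg hSU, if_neg hSU, zero_mul, zero_mul, map_zero, mul_zero, ite_self]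
  simp only [hterm, Finset.sum_ite_eq', Finset.mem_univ, if_true]
  rw [← Finset.mul_sum, ← map_sum, ← Finset.sum_mul]
  simp only [carUnit]
  rw [Finset.sum_coe_sort A.powerset fun S => star (carFrame A S) * carFrame A S,
    sum_star_carFrame_mul, one_mul]

theorem isCARProduct_carProduct {φ : CARAlgebra Γ →L[ℂ] ℂ} (hφ : IsState φ) (he : IsEvenState φ)
    (A : Finset Γ) : IsCARProduct (A : Set Γ) φ φ (carProduct A φ) := by
  have hmul : ∀ a ∈ regionAlgebra (A : Set Γ), ∀ b ∈ regionAlgebra (A : Set Γ)ᶜ,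
      carProduct A φ (a * b) = φ a * φ b := by
    intro a ha b hb
    have h := mem_span_carUnit ha
    clear ha
    induction h using Submodule.span_induction with
    | mem x hx =>
      obtain ⟨S, hS, T, hT, rfl⟩ := hx
      exact carProduct_carUnit_mul he hS hT hb
    | zero => rw [zero_mul, map_zero, map_zero, zero_mul]
    | add x y _ _ hx hy => rw [add_mul, map_add, map_add, add_mul, hx, hy]
    | smul r x _ hx => rw [smul_mul_assoc, map_smul, map_smul, hx, smul_mul_assoc]
  refine ⟨⟨hφ.carProduct_nonneg A, ?_⟩, hmul⟩
  have := hmul 1 (one_mem _) 1 (one_mem _)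
  rwa [mul_one, hφ.map_one, mul_one] at this

/-- Products `a b` with `a ∈ 𝓐(I)` and `b ∈ 𝓐(Iᶜ)` determine a continuous functional. -/
theorem ext_of_forall_mul {I : Set Γ} {ω ω' : CARAlgebra Γ →L[ℂ] ℂ}
    (h : ∀ a ∈ regionAlgebra I, ∀ b ∈ regionAlgebra Iᶜ, ω (a * b) = ω' (a * b)) : ω = ω' := by
  let s : Set (CARAlgebra Γ) :=
    {x | ∃ a ∈ regionAlgebra I, ∃ b ∈ regionAlgebra Iᶜ, x = a * b}
  let W : Submodule ℂ (CARAlgebra Γ) := (Submodule.span ℂ s).topologicalClosure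
  have hWc : IsClosed (W : Set (CARAlgebra Γ)) := Submodule.isClosed_topologicalClosure _
  have hgen : ∀ x : CARAlgebra Γ, (∀ y ∈ s, y * x ∈ s) → x ∈ rightStabilizer W := by
    intro x hx w hw
    have hspan : ∀ v ∈ Submodule.span ℂ s, v * x ∈ Submodule.span ℂ s := by
      intro v hv
      induction hv using Submodule.span_induction with
      | mem v hv => exact Submodule.subset_span (hx v hv)
      | zero => rw [zero_mul]; exact zero_mem _
      | add u v _ _ hu hv => rw [add_mul]; exact add_mem hu hv
      | smul r v _ hv => rw [smul_mul_assoc]; exact Submodule.smul_mem _ r hv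
    have hc : Continuous fun v : CARAlgebra Γ => v * x := continuous_mul_const x
    exact map_mem_closure (f := fun v : CARAlgebra Γ => v * x) hc hw hspan
  -- A generator over `I` moves left past `b` at the cost of replacing `b` by its graded image,
  -- which stays in `𝓐(Iᶜ)`. Since `1 ∈ W`, stability of `W` under all generators will force `W` to
  -- be everything.
  have hs : ∀ i, ∀ y ∈ s, y * carC i ∈ s ∧ y * star (carC i) ∈ s := by
    rintro i _ ⟨a, ha, b, hb, rfl⟩
    by_cases hi : i ∈ I
    · have hg : GradedCommute Iᶜ 1 (carC i) := gradedCommute_carC (by simpa using hi)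
      have hci : carC i ∈ regionAlgebra I := carC_mem_regionAlgebra hi
      refine ⟨⟨a * carC i, mul_mem ha hci, _, carGrading_mem_regionAlgebra hb, ?_⟩,
        ⟨a * star (carC i), mul_mem ha (star_mem hci), _, carGrading_mem_regionAlgebra hb, ?_⟩⟩
      · rw [mul_assoc, hg.mul_eq hb, ← mul_assoc]
        rfl
      · rw [mul_assoc, hg.star.mul_eq hb, ← mul_assoc]
        rfl
    · have hci : carC i ∈ regionAlgebra Iᶜ := carC_mem_regionAlgebra hi
      exact ⟨⟨a, ha, b * carC i, mul_mem hb hci, mul_assoc _ _ _⟩,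
        ⟨a, ha, b * star (carC i), mul_mem hb (star_mem hci), mul_assoc _ _ _⟩⟩
  have hW1 : (1 : CARAlgebra Γ) ∈ W :=
    subset_closure (Submodule.subset_span ⟨1, one_mem _, 1, one_mem _, (mul_one 1).symm⟩)
  have hWle : W ≤ LinearMap.eqLocus (ω : CARAlgebra Γ →ₗ[ℂ] ℂ) (ω' : CARAlgebra Γ →ₗ[ℂ] ℂ) := by
    refine Submodule.topologicalClosure_minimal _ (Submodule.span_le.2 ?_)
      (isClosed_eq ω.continuous ω'.continuous)
    rintro _ ⟨a, ha, b, hb, rfl⟩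
    exact h a ha b hb
  ext x
  have hx : x ∈ rightStabilizer W :=
    regionAlgebra_le (isClosed_rightStabilizer hWc) (fun i _ => hgen _ fun y hy => (hs i y hy).1)
      (fun i _ => hgen _ fun y hy => (hs i y hy).2) (mem_regionAlgebra_univ x)
  have hxW := hx 1 hW1
  rw [one_mul] at hxW
  exact hWle hxW

theorem IsCARProduct.eq {I : Set Γ} {φ ψ ω ω' : CARAlgebra Γ →L[ℂ] ℂ}
    (h : IsCARProduct I φ ψ ω) (h' : IsCARProduct I φ ψ ω') : ω' = ω :=
  ext_of_forall_mul fun a ha b hb => by rw [h.map_mul a ha b hb, h'.map_mul a ha b hb]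

theorem IsCARProduct.apply_left {I : Set Γ} {φ ω : CARAlgebra Γ →L[ℂ] ℂ}
    (h : IsCARProduct I φ φ ω) (hφ : IsState φ) {a : CARAlgebra Γ} (ha : a ∈ regionAlgebra I) :
    ω a = φ a := by
  have := h.map_mul a ha 1 (one_mem _)
  rwa [mul_one, hφ.map_one, mul_one] at this

theorem IsCARProduct.apply_right {I : Set Γ} {φ ω : CARAlgebra Γ →L[ℂ] ℂ}
    (h : IsCARProduct I φ φ ω) (hφ : IsState φ) {b : CARAlgebra Γ} (hb : b ∈ regionAlgebra Iᶜ) :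
    ω b = φ b := by
  have := h.map_mul 1 (one_mem _) b hb
  rwa [one_mul, hφ.map_one, one_mul] at this

/-! ### Additivity of the entropy -/

/-- Configurations on a disjoint union are pairs of configurations. -/
noncomputable def powersetUnionEquiv {A B : Finset Γ} (h : Disjoint A B) :
    A.powerset × B.powerset ≃ (A ∪ B).powerset where
  toFun p := ⟨p.1.1 ∪ p.2.1, Finset.mem_powerset.2 (Finset.union_subset_union
    (Finset.mem_powerset.1 p.1.2) (Finset.mem_powerset.1 p.2.2))⟩
  invFun S := (⟨S.1 ∩ A, Finset.mem_powerset.2 Finset.inter_subset_right⟩,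
    ⟨S.1 ∩ B, Finset.mem_powerset.2 Finset.inter_subset_right⟩)
  left_inv := by
    rintro ⟨⟨S, hS⟩, ⟨T, hT⟩⟩
    rw [Finset.mem_powerset] at hS hT
    have hTA : T ∩ A = ∅ := Finset.disjoint_iff_inter_eq_empty.1 (h.symm.mono_left hT)
    have hSB : S ∩ B = ∅ := Finset.disjoint_iff_inter_eq_empty.1 (h.mono_left hS)
    simp only [Finset.union_inter_distrib_right, hTA, hSB,
      Finset.inter_eq_left.2 hS, Finset.inter_eq_left.2 hT, Finset.union_empty, Finset.empty_union]
  right_inv := by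
    rintro ⟨S, hS⟩
    rw [Finset.mem_powerset] at hS
    simp only [← Finset.inter_union_distrib_left, Finset.inter_eq_left.2 hS]

/-- The factor `ε` comes from reordering monomials on `A ∪ B`, and conjugation by it leaves the
spectrum unchanged. Evenness removes the sign from moving a frame element of `B` past a matrix unit
of `A`, which is not of conjugation form. -/
theorem IsCARProduct.vonNeumannEntropy_union {A B : Finset Γ} (hAB : Disjoint A B)
    {φ ω : CARAlgebra Γ →L[ℂ] ℂ} (hφ : IsState φ) (he : IsEvenState φ)
    (h : IsCARProduct (A : Set Γ) φ φ ω) :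
    vonNeumannEntropy (A ∪ B) ω = vonNeumannEntropy A φ + vonNeumannEntropy B φ := by
  have hBc : (B : Set Γ) ⊆ (A : Set Γ)ᶜ := by
    rw [Set.subset_compl_iff_disjoint_left]
    exact_mod_cast hAB
  choose! ε hε hfr using fun p : A.powerset × B.powerset =>
    exists_sign_carFrame_union hAB (Finset.mem_powerset.1 p.1.2) (Finset.mem_powerset.1 p.2.2)
  have hεε : ∀ p, ε p * ε p = 1 := fun p => by rcases hε p with h | h <;> simp [h]
  have hεs : ∀ p, star (ε p) = ε p := fun p => by rcases hε p with h | h <;> simp [h]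
  have key := Matrix.re_trace_mul_cfc_log_kronecker (hφ.isHermitian_densityMatrix A)
    (hφ.isHermitian_densityMatrix B) (h.isState.isHermitian_densityMatrix (A ∪ B))
    (hφ.trace_densityMatrix A) (hφ.trace_densityMatrix B) (powersetUnionEquiv hAB) ε hεε ?_
  · rw [vonNeumannEntropy, vonNeumannEntropy, vonNeumannEntropy, key]
    ring
  · intro p q
    have hp1 := Finset.mem_powerset.1 p.1.2
    have hp2 := Finset.mem_powerset.1 p.2.2
    have hq1 := Finset.mem_powerset.1 q.1.2
    have hq2 := Finset.mem_powerset.1 q.2.2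
    rw [densityMatrix_apply, densityMatrix_eq_carUnit, densityMatrix_eq_carUnit]
    change ω (star (carFrame (A ∪ B) (q.1.1 ∪ q.2.1)) * carFrame (A ∪ B) (p.1.1 ∪ p.2.1)) = _
    have hcomm := (gradedCommute_carUnit (I := (A : Set Γ)ᶜ) disjoint_compl_right hq1 hp1).mul_eq
      (regionAlgebra_mono hBc (star_mem (carFrame_mem_regionAlgebra hq2)))
    rw [iterate_carGrading_star, iterate_carGrading_of_eq_smul (carGrading_carFrame B q.2.1),
      star_smul, mul_smul_comm] at hcomm
    have hprod : star (carFrame A q.1.1 * carFrame B q.2.1) * (carFrame A p.1.1 * carFrame B p.2.1)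
        = star (carFrame B q.2.1) * carUnit A q.1.1 p.1.1 * carFrame B p.2.1 := by
      rw [star_mul, carUnit]
      simp only [mul_assoc]
    rw [hfr, hfr, star_smul, smul_mul_smul_comm, hεs, hprod, hcomm, smul_mul_assoc, mul_assoc,
      map_smul, map_smul, ← carUnit, h.map_mul _ (carUnit_mem_regionAlgebra hq1 hp1) _
        (regionAlgebra_mono hBc (carUnit_mem_regionAlgebra hq2 hp2)), smul_eq_mul, smul_eq_mul]
    -- For an even matrix unit of `A` the commutation sign is `1`; for an odd one its expectation in
    -- `φ` is zero, so the sign is irrelevant.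
    rcases Nat.even_or_odd (q.1.1.card + p.1.1.card) with hev | hodd
    · rw [← pow_mul, mul_comm q.2.1.card, pow_mul, hev.neg_one_pow, one_pow, star_one]
      ring
    · have h0 : φ (carUnit A q.1.1 p.1.1) = 0 := by
        have h1 := he (carUnit A q.1.1 p.1.1)
        rw [carGrading_carUnit, hodd.neg_one_pow, neg_one_smul, map_neg] at h1
        exact self_eq_neg.1 h1.symm
      rw [h0]
      ring

theorem IsCARProduct.vonNeumannEntropy_right {A B : Finset Γ} (hAB : Disjoint A B)
    {φ ω : CARAlgebra Γ →L[ℂ] ℂ} (hφ : IsState φ) (h : IsCARProduct (A : Set Γ) φ φ ω) :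
    vonNeumannEntropy B ω = vonNeumannEntropy B φ := by
  have hBc : (B : Set Γ) ⊆ (A : Set Γ)ᶜ := by
    rw [Set.subset_compl_iff_disjoint_left]
    exact_mod_cast hAB
  have hD : densityMatrix B ω = densityMatrix B φ := by
    ext S T
    rw [densityMatrix_eq_carUnit, densityMatrix_eq_carUnit]
    exact h.apply_right hφ (regionAlgebra_mono hBc (carUnit_mem_regionAlgebra
      (Finset.mem_powerset.1 T.2) (Finset.mem_powerset.1 S.2)))
  rw [vonNeumannEntropy, vonNeumannEntropy, hD]

/-- By additivity every term of the infimum has the same value, so neither strong subadditivity nor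
a limit is needed. -/
theorem IsCARProduct.condEntropy_eq {A : Finset Γ} {φ ω : CARAlgebra Γ →L[ℂ] ℂ} (hφ : IsState φ)
    (he : IsEvenState φ) (h : IsCARProduct (A : Set Γ) φ φ ω) :
    condEntropy A (A : Set Γ)ᶜ ω = (vonNeumannEntropy A φ : EReal) := by
  -- An infimum over an empty index would be `⊤`; the empty region excludes this.
  have : Nonempty {Λ : Finset Γ // (Λ : Set Γ) ⊆ (A : Set Γ)ᶜ} := ⟨⟨∅, by simp⟩⟩
  rw [condEntropy, ← iInf_const (ι := {Λ : Finset Γ // (Λ : Set Γ) ⊆ (A : Set Γ)ᶜ})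
    (a := (vonNeumannEntropy A φ : EReal))]
  refine iInf_congr fun Λ => ?_
  have hAB : Disjoint A Λ.1 := by
    have := Set.subset_compl_iff_disjoint_left.1 Λ.2
    exact_mod_cast this
  rw [h.vonNeumannEntropy_union hAB hφ he, h.vonNeumannEntropy_right hAB hφ, add_sub_cancel_right]

theorem condEntropy_anti (I : Finset Γ) {J K : Set Γ} (h : J ⊆ K) (ψ : CARAlgebra Γ →L[ℂ] ℂ) :
    condEntropy I K ψ ≤ condEntropy I J ψ :=
  le_iInf fun Λ => iInf_le_of_le ⟨Λ.1, Λ.2.trans h⟩ le_rfl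

end CARProduct

/-! ### The thermal area law. -/

theorem theorem2 {Γ : Type*} (Φ : EvenPotential Γ) (hΦ : Φ.HasSurfaceEnergies)
    (β : ℝ) (hβ : 0 < β) (φ : CARAlgebra Γ →L[ℂ] ℂ) (hφ : IsState φ) (hφ_even : IsEvenState φ)
    (hφ_lts : IsLTS Φ β φ) (A : Finset Γ) :
    ∃ ω : CARAlgebra Γ →L[ℂ] ℂ,
      IsCARProduct (A : Set Γ) φ φ ω ∧
      (∀ ω' : CARAlgebra Γ →L[ℂ] ℂ, IsCARProduct (A : Set Γ) φ φ ω' → ω' = ω) ∧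
      (∀ B : Set Γ, B ⊆ (A : Set Γ)ᶜ →
        mutualEntropy φ A B ≤ mutualEntropy φ A (A : Set Γ)ᶜ) ∧
      mutualEntropy φ A (A : Set Γ)ᶜ ≤
        ((β * ((ω - φ) (Φ.surfaceEnergy A)).re : ℝ) : EReal) ∧
      β * ((ω - φ) (Φ.surfaceEnergy A)).re ≤ 2 * β * ‖Φ.surfaceEnergy A‖ := by
  have hω := isCARProduct_carProduct hφ hφ_even A
  set ω := carProduct A φ
  refine ⟨ω, hω, fun ω' h' => hω.eq h', fun B hB => ?_, ?_, ?_⟩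
  · exact EReal.sub_le_sub le_rfl (condEntropy_anti A hB φ)
  · have hin : ω (Φ.innerHamiltonian A) = φ (Φ.innerHamiltonian A) := by
      refine hω.apply_left hφ (sum_mem fun K hK => ?_)
      exact regionAlgebra_mono (Finset.coe_subset.2 (Finset.mem_powerset.1 hK)) (Φ.mem_region K)
    -- The product state is the trial state: it has the same restriction to `𝓐(Aᶜ)` as `φ`.
    have hlts := hφ_lts A ω hω.isState fun b hb => hω.apply_right hφ hb
    rw [conditionalFreeEnergy, conditionalFreeEnergy, hω.condEntropy_eq hφ hφ_even] at hlts
    rw [mutualEntropy]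
    have hβ' : 0 < β⁻¹ := inv_pos.2 hβ
    generalize condEntropy A (A : Set Γ)ᶜ φ = s at hlts ⊢
    rw [map_add, map_add, hin, Complex.add_re, Complex.add_re] at hlts
    rw [sub_apply, Complex.sub_re]
    induction s with
    -- LTS itself rules out conditional entropy `-∞`: the free energy of `φ` would be `+∞`, while
    -- that of `ω` is finite.
    | bot =>
      rw [EReal.coe_mul_bot_of_pos hβ', EReal.coe_sub_bot, top_le_iff] at hlts
      exact absurd hlts (by
        rw [← EReal.coe_mul, ← EReal.coe_sub]
        exact EReal.coe_ne_top _)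
    | top => simp
    | coe s =>
      rw [← EReal.coe_mul, ← EReal.coe_sub, ← EReal.coe_mul, ← EReal.coe_sub,
        EReal.coe_le_coe_iff] at hlts
      rw [← EReal.coe_sub, EReal.coe_le_coe_iff]
      have h := mul_le_mul_of_nonneg_left hlts hβ.le
      rw [mul_sub, mul_sub, mul_inv_cancel_left₀ hβ.ne', mul_inv_cancel_left₀ hβ.ne'] at h
      linarith
  · have h1 : ((ω - φ) (Φ.surfaceEnergy A)).re ≤ 2 * ‖Φ.surfaceEnergy A‖ := by
      calc ((ω - φ) (Φ.surfaceEnergy A)).re ≤ ‖(ω - φ) (Φ.surfaceEnergy A)‖ := Complex.re_le_norm _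
        _ ≤ ‖ω (Φ.surfaceEnergy A)‖ + ‖φ (Φ.surfaceEnergy A)‖ := norm_sub_le _ _
        _ ≤ 2 * ‖Φ.surfaceEnergy A‖ := by
          have := hω.isState.norm_apply_le (Φ.surfaceEnergy A)
          have := hφ.norm_apply_le (Φ.surfaceEnergy A)
          linarith
    calc _ ≤ β * (2 * ‖Φ.surfaceEnergy A‖) := mul_le_mul_of_nonneg_left h1 hβ.le
      _ = _ := by ring
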